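/- Let $\Omega\subset\mathbb R^3$ be a bounded Lipschitz domain and let $B\subset\Omega$ be a Lipschitz domain (domains are non-empty, open and connected). Fix $L\ge 0$ and $\delta>0$, and let $\mathcal O$ be the set of all open sets $\omega\subset B$ (the empty set being admitted) that are Lipschitz with uniform Lipschitz constant $L$ on neighbourhoods of the uniform radius $\delta$: for every $x_0\in\partial\omega$ there are orthonormal coordinates centred at $x_0$ and a Lipschitz function $g:\mathbb R^2\to\mathbb R$ with constant $L$ such that, for every point with coordinates $y\in\mathbb R^3$, $|y|<\delta$, the point lies in $\omega$ if and only if $y_3>g(y_1,y_2)$. Let $C^1(B)$ denote the space of continuously differentiable functions on $B$ with finite $C^1$-norm. Let $E_d\in C^1(B)^3$; let $\kappa\in C^1(B)$ with $\kappa>0$ on $B$; let $j_c>0$; let $f\in L^2(\Omega)^3\cap C^1(B)^3$; and let $\varepsilon,\nu\in L^\infty(\Omega,\mathbb R^{3\times 3})\cap C^1(B,\mathbb R^{3\times 3})$ be symmetric and uniformly positive definite, i.e. there are $\underline\varepsilon,\underline\nu>0$ with $\xi^{\mathsf T}\varepsilon(x)\xi\ge\underline\varepsilon|\xi|^2$ and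 $\xi^{\mathsf T}\nu(x)\xi\ge\underline\nu|\xi|^2$ for a.e. $x\in\Omega$ and all $\xi\in\mathbb R^3$. Let $H(\mathrm{curl})=\{v\in L^2(\Omega)^3:\operatorname{curl}v\in L^2(\Omega)^3\}$ (distributional curl) with norm $(\|v\|_{L^2}^2+\|\operatorname{curl}v\|_{L^2}^2)^{1/2}$, and let $H_0(\mathrm{curl})$ be the closure of $C_0^\infty(\Omega)^3$ in $H(\mathrm{curl})$. Put $$a(v,w)=\int_\Omega \nu\operatorname{curl}v\cdot\operatorname{curl}w\,dx+\int_\Omega\varepsilon v\cdot w\,dx,\qquad \varphi_\omega(v)=j_c\int_\omega|v|\,dx .$$ Then for every $\omega\in\mathcal O$ there is a unique $E(\omega)\in H_0(\mathrm{curl})$ such that $$a(E(\omega),v-E(\omega))+\varphi_\omega(v)-\varphi_\omega(E(\omega))\ \ge\ \int_\Omega f\cdot(v-E(\omega))\,dx\qquad\text{for all }v\in H_0(\mathrm{curl}),$$ and the shape optimization problem $$\min_{\omega\in\mathcal O}J(\omega),\qquad J(\omega)=\frac12\int_B\kappa\,|E(\omega)-E_d|^2\,dx+\int_\omega dx,$$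 has an optimal solution: there is $\omega_\star\in\mathcal O$ with $J(\omega_\star)\le J(\omega)$ for all $\omega\in\mathcal O$. -/

import Mathlib

open MeasureTheory
open scoped NNReal ENNReal

namespace ShapeOpt

noncomputable section

/-- Euclidean three-space. -/
abbrev E3 := EuclideanSpace ℝ (Fin 3)

/-! ### Lipschitz sets -/

/-- Inside the ball of radius `δ` around `x₀`, and in suitable orthonormal coordinates centred at
`x₀`, the set `U` is the open epigraph of an `L`-Lipschitz function of the first two coordinates. -/
def IsLipschitzGraphNear (U : Set E3) (L : ℝ≥0) (δ : ℝ) (x₀ : E3) : Prop :=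
  ∃ (R : E3 ≃ₗᵢ[ℝ] E3) (g : EuclideanSpace ℝ (Fin 2) → ℝ), LipschitzWith L g ∧
    ∀ y : E3, ‖y‖ < δ → (x₀ + R y ∈ U ↔ g !₂[y 0, y 1] < y 2)

/-- A Lipschitz domain: non-empty, open, connected, with a boundary that is locally the graph of a
Lipschitz function (the Lipschitz constant and the radius may depend on the boundary point). -/
structure IsLipschitzDomain (U : Set E3) : Prop where
  isOpen : IsOpen U
  isConnected : IsConnected U
  lipschitz : ∀ x₀ ∈ frontier U, ∃ (L : ℝ≥0) (δ : ℝ), 0 < δ ∧ IsLipschitzGraphNear U L δ x₀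

/-- The admissible shapes: the open subsets of `B` that are Lipschitz with the uniform Lipschitz
constant `L` (on boundary neighbourhoods of the uniform radius `δ`). -/
def admissibleShapes (B : Set E3) (L : ℝ≥0) (δ : ℝ) : Set (Set E3) :=
  {s | s ⊆ B ∧ IsOpen s ∧ ∀ x₀ ∈ frontier s, IsLipschitzGraphNear s L δ x₀}

/-! ### Function spaces -/

/-- The Banach space `C¹(B)`, for open `B`: continuously differentiable functions on `B` with
finite `C¹`-norm. -/
def MemC1 {F : Type*} [NormedAddCommGroup F] [NormedSpace ℝ F] (B : Set E3) (g : E3 → F) : Prop :=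
  ContDiffOn ℝ 1 g B ∧ ∃ C : ℝ, ∀ x ∈ B, ‖g x‖ ≤ C ∧ ‖fderiv ℝ g x‖ ≤ C

/-- Real square-integrable vector fields on `Ω`. -/
abbrev L2 (Ω : Set E3) := Lp E3 2 (volume.restrict Ω)

/-- The partial derivative `∂ⱼ φᵢ` at `x`. -/
def partialDeriv (φ : E3 → E3) (j i : Fin 3) (x : E3) : ℝ :=
  fderiv ℝ φ x (EuclideanSpace.single j 1) i

/-- The classical curl of a differentiable vector field. -/
def classicalCurl (φ : E3 → E3) (x : E3) : E3 :=
  !₂[partialDeriv φ 1 2 x - partialDeriv φ 2 1 x,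
     partialDeriv φ 2 0 x - partialDeriv φ 0 2 x,
     partialDeriv φ 0 1 x - partialDeriv φ 1 0 x]

/-- Smooth vector fields with compact support in `Ω`. -/
structure IsTestField (Ω : Set E3) (φ : E3 → E3) : Prop where
  contDiff : ContDiff ℝ ((⊤ : ℕ∞) : WithTop ℕ∞) φ
  hasCompactSupport : HasCompactSupport φ
  tsupport_subset : tsupport φ ⊆ Ω

theorem IsTestField.memLp {Ω : Set E3} {φ : E3 → E3} (h : IsTestField Ω φ) :
    MemLp φ 2 (volume.restrict Ω) :=
  (h.contDiff.continuous.memLp_of_hasCompactSupport h.hasCompactSupport).restrict Ω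

theorem IsTestField.curl_memLp {Ω : Set E3} {φ : E3 → E3} (h : IsTestField Ω φ) :
    MemLp (classicalCurl φ) 2 (volume.restrict Ω) := by
  refine (Continuous.memLp_of_hasCompactSupport ?_ ?_).restrict Ω
  · have hf : Continuous (fderiv ℝ φ) := h.contDiff.continuous_fderiv (by simp)
    have hp : ∀ j i, Continuous (partialDeriv φ j i) := fun j i => by
      unfold partialDeriv
      fun_prop
    unfold classicalCurl
    refine (PiLp.continuous_toLp 2 _).comp (continuous_pi fun i => ?_)
    fin_cases i
    · exact (hp 1 2).sub (hp 2 1)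
    · exact (hp 2 0).sub (hp 0 2)
    · exact (hp 0 1).sub (hp 1 0)
  · refine (h.hasCompactSupport.fderiv ℝ).mono ?_
    intro x hx
    contrapose! hx
    have h0 : fderiv ℝ φ x = 0 := by simpa using hx
    simp only [Function.mem_support, not_not]
    ext i
    fin_cases i <;> simp [classicalCurl, partialDeriv, h0]

theorem IsTestField.add {Ω : Set E3} {φ ψ : E3 → E3} (h : IsTestField Ω φ)
    (h' : IsTestField Ω ψ) : IsTestField Ω (φ + ψ) where
  contDiff := h.contDiff.add h'.contDiff
  hasCompactSupport := h.hasCompactSupport.add h'.hasCompactSupport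
  tsupport_subset := (tsupport_add φ ψ).trans
    (Set.union_subset h.tsupport_subset h'.tsupport_subset)

theorem IsTestField.const_smul {Ω : Set E3} {φ : E3 → E3} (c : ℝ) (h : IsTestField Ω φ) :
    IsTestField Ω (c • φ) where
  contDiff := h.contDiff.const_smul c
  hasCompactSupport := h.hasCompactSupport.mono (Function.support_const_smul_subset c φ)
  tsupport_subset :=
    (closure_mono (Function.support_const_smul_subset c φ)).trans h.tsupport_subset

theorem IsTestField.zero (Ω : Set E3) : IsTestField Ω 0 where
  contDiff := contDiff_const
  hasCompactSupport := HasCompactSupport.zero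
  tsupport_subset := by simp

/-- The space `H(curl)` on `Ω`. A vector field `v` in `L²` with distributional curl `w` in `L²` is
represented by the pair `(v, w)` (the second entry is determined by the first one when `Ω` is
open), and the norm is the graph norm `(‖v‖² + ‖curl v‖²)^(1/2)`. -/
def HCurl (Ω : Set E3) : Submodule ℝ (WithLp 2 (L2 Ω × L2 Ω)) where
  carrier := {u | ∀ φ : E3 → E3, IsTestField Ω φ →
    ∫ x in Ω, inner ℝ (u.fst x) (classicalCurl φ x) = ∫ x in Ω, inner ℝ (u.snd x) (φ x)}
  zero_mem' := by
    intro φ _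
    have h : ∀ ψ : E3 → E3, ∫ x in Ω, inner ℝ ((0 : L2 Ω) x) (ψ x) = 0 := fun ψ => by
      refine integral_eq_zero_of_ae ?_
      filter_upwards [Lp.coeFn_zero E3 2 (volume.restrict Ω)] with x hx
      rw [hx]
      simp
    exact (h _).trans (h _).symm
  add_mem' := by
    intro u v hu hv φ hφ
    have hi : ∀ (a : L2 Ω) (ψ : E3 → E3), MemLp ψ 2 (volume.restrict Ω) →
        Integrable (fun x => inner ℝ (a x) (ψ x)) (volume.restrict Ω) := by
      intro a ψ hψ
      refine (L2.integrable_inner (𝕜 := ℝ) a hψ.toLp).congr ?_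
      filter_upwards [hψ.coeFn_toLp] with x hx
      rw [hx]
    have h : ∀ (a b : L2 Ω) (ψ : E3 → E3), MemLp ψ 2 (volume.restrict Ω) →
        ∫ x in Ω, inner ℝ ((a + b : L2 Ω) x) (ψ x)
          = (∫ x in Ω, inner ℝ (a x) (ψ x)) + ∫ x in Ω, inner ℝ (b x) (ψ x) := by
      intro a b ψ hψ
      rw [← integral_add (hi a ψ hψ) (hi b ψ hψ)]
      refine integral_congr_ae ?_
      filter_upwards [Lp.coeFn_add a b] with x hx
      rw [hx]
      exact inner_add_left _ _ _
    have h1 := h u.fst v.fst _ hφ.curl_memLp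
    have h2 := h u.snd v.snd _ hφ.memLp
    exact h1.trans ((congrArg₂ (· + ·) (hu φ hφ) (hv φ hφ)).trans h2.symm)
  smul_mem' := by
    intro c u hu φ hφ
    have h : ∀ (a : L2 Ω) (ψ : E3 → E3),
        ∫ x in Ω, inner ℝ ((c • a : L2 Ω) x) (ψ x) = c * ∫ x in Ω, inner ℝ (a x) (ψ x) := by
      intro a ψ
      rw [← integral_const_mul]
      refine integral_congr_ae ?_
      filter_upwards [Lp.coeFn_smul c a] with x hx
      simp [hx, inner_smul_left]
    exact (h u.fst _).trans ((congrArg (c * ·) (hu φ hφ)).trans (h u.snd _).symm)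

/-- The vector field underlying an element of `H(curl)`. -/
def vecField {Ω : Set E3} (u : HCurl Ω) : L2 Ω := (u : WithLp 2 (L2 Ω × L2 Ω)).fst

/-- The distributional curl of an element of `H(curl)`. -/
def curlField {Ω : Set E3} (u : HCurl Ω) : L2 Ω := (u : WithLp 2 (L2 Ω × L2 Ω)).snd

/-- The elements of `H(curl)` given by smooth vector fields with compact support in `Ω`. -/
def testFields (Ω : Set E3) : Submodule ℝ (HCurl Ω) where
  carrier := {u | ∃ φ : E3 → E3, IsTestField Ω φ ∧ vecField u =ᵐ[volume.restrict Ω] φ}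
  zero_mem' := ⟨0, IsTestField.zero Ω, Lp.coeFn_zero E3 2 (volume.restrict Ω)⟩
  add_mem' := by
    rintro u v ⟨φ, hφ, hu⟩ ⟨ψ, hψ, hv⟩
    exact ⟨φ + ψ, hφ.add hψ, (Lp.coeFn_add (vecField u) (vecField v)).trans (hu.add hv)⟩
  smul_mem' := by
    rintro c u ⟨φ, hφ, hu⟩
    exact ⟨c • φ, hφ.const_smul c, (Lp.coeFn_smul c (vecField u)).trans (hu.const_smul c)⟩

/-- `H₀(curl)`: the closure of the compactly supported smooth fields in the `H(curl)`-norm. -/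
def H0Curl (Ω : Set E3) : Submodule ℝ (HCurl Ω) := (testFields Ω).topologicalClosure

/-! ### The variational inequality and the cost functional -/

/-- Matrix-valued coefficients in `L^∞(Ω)` that are continuously differentiable on `B`, symmetric
and uniformly positive definite on `Ω`. -/
structure IsMaterialParameter (Ω B : Set E3) (A : E3 → Matrix (Fin 3) (Fin 3) ℝ) : Prop where
  memLp_top : ∀ i j, MemLp (fun x => A x i j) ∞ (volume.restrict Ω)
  memC1 : ∀ i j, MemC1 B (fun x => A x i j)
  symm : ∀ᵐ x ∂(volume.restrict Ω), (A x).IsSymm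
  posDef : ∃ c : ℝ, 0 < c ∧ ∀ᵐ x ∂(volume.restrict Ω), ∀ ξ : E3,
    c * ‖ξ‖ ^ 2 ≤ inner ℝ ξ (Matrix.toEuclideanLin (A x) ξ)

/-- The bilinear form `a(v, w) = ∫_Ω ν curl v · curl w + ∫_Ω ε v · w`. -/
def curlForm {Ω : Set E3} (ν ε : E3 → Matrix (Fin 3) (Fin 3) ℝ) (v w : HCurl Ω) : ℝ :=
  (∫ x in Ω, inner ℝ (Matrix.toEuclideanLin (ν x) (curlField v x)) (curlField w x)) +
    ∫ x in Ω, inner ℝ (Matrix.toEuclideanLin (ε x) (vecField v x)) (vecField w x)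

/-- The non-smooth functional `φ_s(v) = j_c ∫_s |v|`. -/
def nonsmooth (jc : ℝ) (s : Set E3) (v : E3 → E3) : ℝ := jc * ∫ x in s, ‖v x‖

/-- `e` is a solution in `H₀(curl)` of the variational inequality associated with the shape `s`. -/
def IsVISolution {Ω : Set E3} (ν ε : E3 → Matrix (Fin 3) (Fin 3) ℝ) (jc : ℝ) (f : E3 → E3)
    (s : Set E3) (e : HCurl Ω) : Prop :=
  e ∈ H0Curl Ω ∧ ∀ v ∈ H0Curl Ω,
    (∫ x in Ω, inner ℝ (f x) (vecField (v - e) x)) ≤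
      curlForm ν ε e (v - e) + nonsmooth jc s (vecField v) - nonsmooth jc s (vecField e)

/-- The electric field `E(s)`: the solution of the variational inequality associated with `s`. -/
def electricField (Ω : Set E3) (ν ε : E3 → Matrix (Fin 3) (Fin 3) ℝ) (jc : ℝ) (f : E3 → E3)
    (s : Set E3) : HCurl Ω :=
  Classical.epsilon (IsVISolution ν ε jc f s)

/-- The cost functional `J(s) = 1/2 ∫_B κ |E(s) - E_d|² + ∫_s 1`. -/
def cost (Ω B : Set E3) (ν ε : E3 → Matrix (Fin 3) (Fin 3) ℝ) (jc : ℝ) (f : E3 → E3)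
    (κ : E3 → ℝ) (Ed : E3 → E3) (s : Set E3) : ℝ :=
  1 / 2 * (∫ x in B, κ x * ‖vecField (electricField Ω ν ε jc f s) x - Ed x‖ ^ 2) +
    ∫ _x in s, (1 : ℝ)

end

end ShapeOpt

open ShapeOpt

/-!
For a fixed shape the field is the minimizer of the strongly convex energy
`½ a(v, v) + φ_s(v) - ∫ f · v`. Subtracting the inequalities for two shapes gives
`‖E(s) - E(t)‖ ≤ C |s ∆ t|^(1/2)`, so the cost is continuous for convergence in measure and it
suffices that the admissible shapes are compact for it. Along an ultrafilter of admissible shapes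
take the set `t` of the points that have a neighbourhood contained in almost all shapes. A point of
`∂t` is a limit of boundary points of the shapes; the coordinate frames and the Lipschitz height
functions at these points converge as well, and the limits describe `t` near the point, with the
same constants. Around a boundary point the points in undecided position lie on a Lipschitz graph,
hence form a null set.
-/

namespace ShapeOpt

open Filter Topology Metric Set

/-! ### Limits of sets along a filter -/

section SetLimits

variable {X : Type*} [TopologicalSpace X]

/-- The inner limit of a filter of sets: the points with a neighbourhood eventually contained in
the sets, in the product-filter form that makes moving base points easy to handle. -/
def innerLimit (l : Filter (Set X)) : Set X := {x | ∀ᶠ p in l ×ˢ 𝓝 x, p.2 ∈ p.1}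

/-- The outer limit of a filter of sets: the points with a neighbourhood eventually disjoint from
the sets. -/
def outerLimit (l : Filter (Set X)) : Set X := {x | ∀ᶠ p in l ×ˢ 𝓝 x, p.2 ∉ p.1}

/-- The limit boundary of a filter of sets: the points near which membership in the sets does not
stabilise. -/
def limitBoundary (l : Filter (Set X)) : Set X := (innerLimit l ∪ outerLimit l)ᶜ

theorem isOpen_setOf_eventually_prod_nhds {Y : Type*} (l : Filter Y) (P : Y × X → Prop) :
    IsOpen {x | ∀ᶠ p in l ×ˢ 𝓝 x, P p} := by
  refine isOpen_iff_mem_nhds.2 fun x hx => ?_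
  obtain ⟨pa, ha, pb, hb, h⟩ := eventually_prod_iff.1 hx
  filter_upwards [eventually_eventually_nhds.2 hb] with y hy
  exact eventually_prod_iff.2 ⟨pa, ha, pb, hy, h⟩

theorem isOpen_innerLimit (l : Filter (Set X)) : IsOpen (innerLimit l) :=
  isOpen_setOf_eventually_prod_nhds l _

theorem isOpen_outerLimit (l : Filter (Set X)) : IsOpen (outerLimit l) :=
  isOpen_setOf_eventually_prod_nhds l _

theorem eventually_mem_of_mem_innerLimit {l : Filter (Set X)} {x : X} (hx : x ∈ innerLimit l) :
    ∀ᶠ s in l, x ∈ s :=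
  Eventually.curry hx |>.mono fun _ h => h.self_of_nhds

theorem eventually_notMem_of_mem_outerLimit {l : Filter (Set X)} {x : X}
    (hx : x ∈ outerLimit l) : ∀ᶠ s in l, x ∉ s :=
  Eventually.curry hx |>.mono fun _ h => h.self_of_nhds

theorem disjoint_innerLimit_outerLimit (l : Filter (Set X)) [l.NeBot] :
    Disjoint (innerLimit l) (outerLimit l) := by
  refine Set.disjoint_left.2 fun x hi ho => ?_
  obtain ⟨s, hs, hs'⟩ :=
    ((eventually_mem_of_mem_innerLimit hi).and (eventually_notMem_of_mem_outerLimit ho)).exists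
  exact hs' hs

theorem innerLimit_subset {l : Filter (Set X)} [l.NeBot] {B : Set X} (h : ∀ᶠ s in l, s ⊆ B) :
    innerLimit l ⊆ B := fun _ hx =>
  let ⟨_, hs, hxs⟩ := (h.and (eventually_mem_of_mem_innerLimit hx)).exists
  hs hxs

theorem frontier_innerLimit_subset (l : Filter (Set X)) [l.NeBot] :
    frontier (innerLimit l) ⊆ limitBoundary l := by
  rw [(isOpen_innerLimit l).frontier_eq]
  rintro x ⟨hcl, hx⟩ (hi | ho)
  · exact hx hi
  · exact ((disjoint_innerLimit_outerLimit l).closure_left (isOpen_outerLimit l)).le_bot ⟨hcl, ho⟩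

theorem limitBoundary_pure (s : Set X) : limitBoundary (pure s) = frontier s := by
  have hinner : innerLimit (pure s) = interior s := by
    ext x
    simp [innerLimit, mem_interior_iff_mem_nhds, pure_prod, Filter.Eventually]
  have houter : outerLimit (pure s) = interior sᶜ := by
    ext x
    simp only [outerLimit, mem_interior_iff_mem_nhds, pure_prod]
    rfl
  rw [limitBoundary, hinner, houter, interior_compl, compl_union, compl_compl, inter_comm]
  rfl

theorem eventually_disjoint_symmDiff_innerLimit {l : Filter (Set X)} [l.NeBot] {K : Set X}
    (hK : IsCompact K) (h : K ⊆ innerLimit l ∪ outerLimit l) :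
    ∀ᶠ s in l, Disjoint (symmDiff s (innerLimit l)) K := by
  have hlocal : ∀ x ∈ K, ∀ᶠ p in l ×ˢ 𝓝 x, p.2 ∈ p.1 ↔ p.2 ∈ innerLimit l := fun x hx => by
    rcases h hx with hi | ho
    · have hmem := tendsto_snd (f := l).eventually ((isOpen_innerLimit l).mem_nhds hi)
      filter_upwards [hi, hmem] with p hp hpi using iff_of_true hp hpi
    · have hmem := tendsto_snd (f := l).eventually ((isOpen_outerLimit l).mem_nhds ho)
      filter_upwards [ho, hmem] with p hp hpo
      exact iff_of_false hp fun hpi => (disjoint_innerLimit_outerLimit l).le_bot ⟨hpi, hpo⟩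
  have hK : ∀ᶠ s in l, ∀ x ∈ K, x ∈ s ↔ x ∈ innerLimit l :=
    (Eventually.curry (hK.mem_prod_nhdsSet_of_forall hlocal)).mono fun s hs => hs.self_of_nhdsSet
  filter_upwards [hK] with s hs
  exact Set.disjoint_left.2 fun x hd hx => hd.elim (fun hd => hd.2 ((hs x hx).1 hd.1))
    fun hd => hd.2 ((hs x hx).2 hd.1)

theorem tendsto_measure_symmDiff_innerLimit [T2Space X] [MeasurableSpace X]
    [OpensMeasurableSpace X] {μ : Measure X} [IsFiniteMeasure μ] [μ.InnerRegularCompactLTTop]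
    {l : Filter (Set X)} [l.NeBot] (h : μ (limitBoundary l) = 0) :
    Tendsto (fun s => μ (symmDiff s (innerLimit l))) l (𝓝 0) := by
  have hO : IsOpen (innerLimit l ∪ outerLimit l) :=
    (isOpen_innerLimit l).union (isOpen_outerLimit l)
  refine ENNReal.tendsto_nhds_zero.2 fun η hη => ?_
  obtain ⟨K, hKO, hK, hKη⟩ :=
    hO.measurableSet.exists_isCompact_sdiff_lt (measure_ne_top μ _) hη.ne'
  filter_upwards [eventually_disjoint_symmDiff_innerLimit hK hKO] with s hs
  calc μ (symmDiff s (innerLimit l))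
      ≤ μ ((innerLimit l ∪ outerLimit l) \ K ∪ limitBoundary l) := measure_mono fun x hx =>
        (em (x ∈ innerLimit l ∪ outerLimit l)).imp
          (fun hxO => ⟨hxO, fun hxK => hs.le_bot ⟨hx, hxK⟩⟩) id
    _ ≤ η := (measure_union_le _ _).trans (by rw [h, add_zero]; exact hKη.le)

theorem inter_frontier_nonempty_of_isPreconnected {s V : Set X} (hV : IsPreconnected V)
    (hs : (V ∩ s).Nonempty) (hVs : ¬ V ⊆ s) : (V ∩ frontier s).Nonempty := by
  by_contra hne
  have hcover : V ⊆ interior s ∪ interior sᶜ := fun w hw => by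
    rw [interior_compl, ← compl_compl (interior s), ← compl_inter]
    exact fun ⟨hint, hcl⟩ => hne ⟨w, hw, hcl, hint⟩
  have hdisj : Disjoint (interior s) (interior sᶜ) :=
    disjoint_compl_right.mono interior_subset interior_subset
  obtain ⟨b, hbV, hbs⟩ := hs
  have hb : b ∈ interior s :=
    (hcover hbV).resolve_right fun hb => interior_subset hb hbs
  exact hVs ((hV.subset_left_of_subset_union isOpen_interior isOpen_interior hdisj hcover
    ⟨b, hbV, hb⟩).trans interior_subset)

theorem eventually_inter_frontier_nonempty {U : Ultrafilter (Set X)} {x : X}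
    (hx : x ∈ limitBoundary (U : Filter (Set X))) {V : Set X} (hV : V ∈ 𝓝 x)
    (hVc : IsPreconnected V) : ∀ᶠ s in (U : Filter (Set X)), (V ∩ frontier s).Nonempty := by
  have hinner : ¬ ∀ᶠ s in (U : Filter (Set X)), V ⊆ s := fun h =>
    hx (Or.inl ((h.prod_mk hV).mono fun p hp => hp.1 hp.2))
  have houter : ¬ ∀ᶠ s in (U : Filter (Set X)), V ⊆ sᶜ := fun h =>
    hx (Or.inr ((h.prod_mk hV).mono fun p hp => hp.1 hp.2))
  filter_upwards [Ultrafilter.eventually_not.2 hinner, Ultrafilter.eventually_not.2 houter]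
    with s hi ho
  refine inter_frontier_nonempty_of_isPreconnected hVc ?_ hi
  obtain ⟨b, hb, hbs⟩ := not_subset.1 ho
  exact ⟨b, hb, notMem_compl_iff.1 hbs⟩

end SetLimits

theorem exists_tendsto_eventually_mem {ι X : Type*} [PseudoMetricSpace X] [ProperSpace X]
    {l : Filter ι} {A : ι → Set X} (hA : ∀ i, IsClosed (A i)) {x : X}
    (h : ∀ r > 0, ∀ᶠ i in l, (ball x r ∩ A i).Nonempty) :
    ∃ z : ι → X, Tendsto z l (𝓝 x) ∧ ∀ᶠ i in l, z i ∈ A i := by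
  have hne : ∀ᶠ i in l, (A i).Nonempty := (h 1 one_pos).mono fun i hi => hi.right
  have : Nonempty X := ⟨x⟩
  choose! z hzA hz using fun i (hi : (A i).Nonempty) => (hA i).exists_infDist_eq_dist hi x
  refine ⟨z, Metric.tendsto_nhds.2 fun r hr => ?_, hne.mono hzA⟩
  filter_upwards [h r hr] with i ⟨y, hyr, hy⟩
  calc dist (z i) x = infDist x (A i) := by rw [hz i ⟨y, hy⟩, dist_comm]
    _ ≤ dist x y := infDist_le_dist_of_mem hy
    _ < r := by rwa [dist_comm]

theorem exists_tendsto_mem_frontier {E : Type*} [NormedAddCommGroup E] [NormedSpace ℝ E]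
    [ProperSpace E] {U : Ultrafilter (Set E)} {x : E}
    (hx : x ∈ limitBoundary (U : Filter (Set E))) :
    ∃ z : Set E → E, Tendsto z U (𝓝 x) ∧ ∀ᶠ s in (U : Filter (Set E)), z s ∈ frontier s :=
  exists_tendsto_eventually_mem (fun _ => isClosed_frontier) fun _ hr =>
    eventually_inter_frontier_nonempty hx (ball_mem_nhds x hr) (convex_ball x _).isPreconnected

/-! ### Sets given near a point by a height function -/

section Superlevel

variable {E : Type*} [NormedAddCommGroup E] [NormedSpace ℝ E]

/-- In the ball of radius `δ` around `z`, and in the orthonormal frame `R` centred at `z`, the set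
`s` is the region where `F` is positive. For the height above the graph of `g` this is the
condition in `IsLipschitzGraphNear`. -/
def IsSuperlevelNear (s : Set E) (δ : ℝ) (z : E) (R : E ≃ₗᵢ[ℝ] E) (F : E → ℝ) : Prop :=
  ∀ y, ‖y‖ < δ → (z + R y ∈ s ↔ 0 < F y)

/-- Along the filter `l` of sets, the set `s` is eventually the region where `F s` is positive, in
the frame `R s` centred at `z s`, and centres, frames and functions converge to `x`, `R₀` and `F₀`
(the functions jointly with their argument). -/
structure TendstoSuperlevel (l : Filter (Set E)) (δ : ℝ) (z : Set E → E) (R : Set E → E ≃ₗᵢ[ℝ] E)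
    (F : Set E → E → ℝ) (x : E) (R₀ : E ≃ₗᵢ[ℝ] E) (F₀ : E → ℝ) : Prop where
  eventually_isSuperlevelNear : ∀ᶠ s in l, IsSuperlevelNear s δ (z s) (R s) (F s)
  tendsto_center : Tendsto z l (𝓝 x)
  tendsto_frame : ∀ y, Tendsto (fun s => R s y) l (𝓝 (R₀ y))
  tendsto_height : ∀ y, Tendsto (fun p : Set E × E => F p.1 p.2) (l ×ˢ 𝓝 y) (𝓝 (F₀ y))

namespace TendstoSuperlevel

variable {l : Filter (Set E)} {δ : ℝ} {z : Set E → E} {R : Set E → E ≃ₗᵢ[ℝ] E}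
  {F : Set E → E → ℝ} {x : E} {R₀ : E ≃ₗᵢ[ℝ] E} {F₀ : E → ℝ}

theorem tendsto_frame_symm (h : TendstoSuperlevel l δ z R F x R₀ F₀) (y : E) :
    Tendsto (fun p : Set E × E => (R p.1).symm (p.2 - z p.1)) (l ×ˢ 𝓝 (x + R₀ y)) (𝓝 y) := by
  refine tendsto_iff_dist_tendsto_zero.2 ?_
  have hdist : ∀ p : Set E × E,
      dist ((R p.1).symm (p.2 - z p.1)) y = dist (p.2 - z p.1) (R p.1 y) := fun p => by
    rw [← (R p.1).dist_map, LinearIsometryEquiv.apply_symm_apply]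
  have hlim : Tendsto (fun p : Set E × E => dist (p.2 - z p.1) (R p.1 y)) (l ×ˢ 𝓝 (x + R₀ y))
      (𝓝 (dist (x + R₀ y - x) (R₀ y))) :=
    (tendsto_snd.sub (h.tendsto_center.comp tendsto_fst)).dist
      ((h.tendsto_frame y).comp tendsto_fst)
  rw [add_sub_cancel_left, dist_self] at hlim
  exact hlim.congr fun p => (hdist p).symm

theorem eventually_mem_iff (h : TendstoSuperlevel l δ z R F x R₀ F₀) {y : E} (hy : ‖y‖ < δ) :
    ∀ᶠ p in l ×ˢ 𝓝 (x + R₀ y), p.2 ∈ p.1 ↔ 0 < F p.1 ((R p.1).symm (p.2 - z p.1)) := by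
  filter_upwards [tendsto_fst.eventually h.eventually_isSuperlevelNear,
    (h.tendsto_frame_symm y).norm.eventually (gt_mem_nhds hy)] with p hp hpδ
  simpa using hp _ hpδ

theorem tendsto_height_frame_symm (h : TendstoSuperlevel l δ z R F x R₀ F₀) (y : E) :
    Tendsto (fun p : Set E × E => F p.1 ((R p.1).symm (p.2 - z p.1))) (l ×ˢ 𝓝 (x + R₀ y))
      (𝓝 (F₀ y)) :=
  (h.tendsto_height y).comp (tendsto_fst.prodMk (h.tendsto_frame_symm y))

theorem add_mem_innerLimit (h : TendstoSuperlevel l δ z R F x R₀ F₀) {y : E} (hy : ‖y‖ < δ)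
    (hpos : 0 < F₀ y) : x + R₀ y ∈ innerLimit l := by
  filter_upwards [h.eventually_mem_iff hy,
    (h.tendsto_height_frame_symm y).eventually (lt_mem_nhds hpos)] with p hp using hp.2

theorem add_mem_outerLimit (h : TendstoSuperlevel l δ z R F x R₀ F₀) {y : E} (hy : ‖y‖ < δ)
    (hneg : F₀ y < 0) : x + R₀ y ∈ outerLimit l := by
  filter_upwards [h.eventually_mem_iff hy,
    (h.tendsto_height_frame_symm y).eventually (gt_mem_nhds hneg)] with p hp hpneg hmem
  exact hpneg.not_gt (hp.1 hmem)

theorem apply_eq_zero_of_add_mem_limitBoundary (h : TendstoSuperlevel l δ z R F x R₀ F₀) {y : E}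
    (hy : ‖y‖ < δ) (hmem : x + R₀ y ∈ limitBoundary l) : F₀ y = 0 := by
  rcases lt_trichotomy (F₀ y) 0 with hneg | hzero | hpos
  · exact (hmem (Or.inr (h.add_mem_outerLimit hy hneg))).elim
  · exact hzero
  · exact (hmem (Or.inl (h.add_mem_innerLimit hy hpos))).elim

theorem isSuperlevelNear_innerLimit [l.NeBot] (h : TendstoSuperlevel l δ z R F x R₀ F₀) {e : E}
    (he : ∀ y (t : ℝ), F₀ (y + t • e) = F₀ y + t) :
    IsSuperlevelNear (innerLimit l) δ x R₀ F₀ := by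
  refine fun y hy => ⟨fun hmem => ?_, h.add_mem_innerLimit hy⟩
  by_contra! hle
  -- Moving down along `e` makes the height negative while staying in the open inner limit.
  have hdown : Tendsto (fun t : ℝ => y + t • e) (𝓝[<] 0) (𝓝 y) :=
    ((continuous_const.add (continuous_id.smul continuous_const)).tendsto' 0 y
      (by simp)).mono_left nhdsWithin_le_nhds
  have hinner : ∀ᶠ t : ℝ in 𝓝[<] 0, x + R₀ (y + t • e) ∈ innerLimit l :=
    (((R₀.continuous.const_add x).tendsto y).comp hdown).eventually
      ((isOpen_innerLimit l).mem_nhds hmem)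
  obtain ⟨t, ⟨htδ, ht⟩, htneg⟩ := ((hdown.norm.eventually (gt_mem_nhds hy)).and hinner).and
    self_mem_nhdsWithin |>.exists
  have hneg : F₀ (y + t • e) < 0 := by
    rw [he]
    exact add_neg_of_nonpos_of_neg hle htneg
  exact (disjoint_innerLimit_outerLimit l).le_bot ⟨ht, h.add_mem_outerLimit htδ hneg⟩

end TendstoSuperlevel

theorem IsSuperlevelNear.apply_zero_of_mem_frontier {s : Set E} {δ : ℝ} {z : E}
    {R : E ≃ₗᵢ[ℝ] E} {F : E → ℝ} (h : IsSuperlevelNear s δ z R F) (hδ : 0 < δ)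
    (hF : Continuous F) (hz : z ∈ frontier s) : F 0 = 0 := by
  have hconst : TendstoSuperlevel (pure s) δ (fun _ => z) (fun _ => R) (fun _ => F) z R F :=
    { eventually_isSuperlevelNear := eventually_pure.2 h
      tendsto_center := tendsto_const_nhds
      tendsto_frame := fun _ => tendsto_const_nhds
      tendsto_height := fun y => (hF.tendsto y).comp tendsto_snd }
  refine hconst.apply_eq_zero_of_add_mem_limitBoundary (by simpa using hδ) ?_
  rwa [map_zero, add_zero, limitBoundary_pure]

theorem measure_setOf_eq_zero_of_translation [FiniteDimensional ℝ E] [MeasurableSpace E]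
    [BorelSpace E] (μ : Measure E) [μ.IsAddHaarMeasure] {F : E → ℝ} (hF : Measurable F) {e : E}
    (he : ∀ y (t : ℝ), F (y + t • e) = F y + t) : μ {y | F y = 0} = 0 := by
  have hbdd : Bornology.IsBounded (range fun n : ℕ => ((n : ℝ) + 1)⁻¹ • e) := by
    refine isBounded_iff_forall_norm_le.2 ⟨‖e‖, ?_⟩
    rintro _ ⟨n, rfl⟩
    rw [norm_smul, norm_inv, Real.norm_of_nonneg (by positivity)]
    exact mul_le_of_le_one_left (norm_nonneg e)
      (inv_le_one_of_one_le₀ (le_add_of_nonneg_left n.cast_nonneg))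
  refine Measure.addHaar_eq_zero_of_disjoint_translates μ _ hbdd ?_ (hF (measurableSet_singleton 0))
  intro m n hmn
  refine Set.disjoint_left.2 ?_
  simp only [singleton_add]
  rintro _ ⟨a, ha, rfl⟩ ⟨b, hb, hab⟩
  have hheight : F (b + ((n : ℝ) + 1)⁻¹ • e) = F (a + ((m : ℝ) + 1)⁻¹ • e) := by
    rw [add_comm b, add_comm a]
    exact congrArg F hab
  rw [he, he, show F a = 0 from ha, show F b = 0 from hb, zero_add, zero_add, inv_inj,
    add_left_inj] at hheight
  exact hmn (Nat.cast_injective hheight).symm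

theorem TendstoSuperlevel.measure_limitBoundary_inter_ball_eq_zero [FiniteDimensional ℝ E]
    [MeasurableSpace E] [BorelSpace E] (μ : Measure E) [μ.IsAddHaarMeasure]
    {l : Filter (Set E)} {δ : ℝ} {z : Set E → E} {R : Set E → E ≃ₗᵢ[ℝ] E} {F : Set E → E → ℝ}
    {x : E} {R₀ : E ≃ₗᵢ[ℝ] E} {F₀ : E → ℝ} (h : TendstoSuperlevel l δ z R F x R₀ F₀)
    (hF₀ : Measurable F₀) {e : E} (he : ∀ y (t : ℝ), F₀ (y + t • e) = F₀ y + t) :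
    μ (limitBoundary l ∩ ball x δ) = 0 := by
  have hG : Measurable fun w => F₀ (R₀.symm (w - x)) :=
    hF₀.comp (R₀.symm.continuous.comp (continuous_id.sub continuous_const)).measurable
  refine measure_mono_null (fun w hw => ?_)
    (measure_setOf_eq_zero_of_translation μ hG (e := R₀ e) fun w t => ?_)
  · refine h.apply_eq_zero_of_add_mem_limitBoundary ?_ ?_
    · rw [LinearIsometryEquiv.norm_map, ← dist_eq_norm]
      exact hw.2
    · rw [LinearIsometryEquiv.apply_symm_apply, add_sub_cancel]
      exact hw.1
  · rw [add_sub_right_comm, map_add, map_smul, LinearIsometryEquiv.symm_apply_apply, he]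

end Superlevel

/-! ### Compactness of the admissible shapes -/

theorem exists_tendsto_of_eventually_norm_le {ι F : Type*} [NormedAddCommGroup F] [ProperSpace F]
    {U : Ultrafilter ι} {f : ι → F} {C : ℝ} (h : ∀ᶠ i in (U : Filter ι), ‖f i‖ ≤ C) :
    ∃ y, Tendsto f U (𝓝 y) := by
  obtain ⟨y, -, hy⟩ := (isCompact_closedBall (0 : F) C).ultrafilter_le_nhds (U.map f)
    (le_principal_iff.2 (h.mono fun i hi => mem_closedBall_zero_iff.2 hi))
  exact ⟨y, hy⟩

theorem exists_tendsto_linearIsometryEquiv {ι E : Type*} [NormedAddCommGroup E]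
    [NormedSpace ℝ E] [FiniteDimensional ℝ E] (U : Ultrafilter ι) (R : ι → E ≃ₗᵢ[ℝ] E) :
    ∃ R₀ : E ≃ₗᵢ[ℝ] E, ∀ y, Tendsto (fun i => R i y) U (𝓝 (R₀ y)) := by
  have := FiniteDimensional.proper_real E
  have h : ∀ y : E, ∃ z, Tendsto (fun i => R i y) U (𝓝 z) := fun y =>
    exists_tendsto_of_eventually_norm_le (C := ‖y‖)
      (Eventually.of_forall fun i => ((R i).norm_map y).le)
  choose S hS using h
  let T : E →ₗᵢ[ℝ] E :=
    { toFun := S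
      map_add' := fun x y => tendsto_nhds_unique (hS (x + y)) (by simpa using (hS x).add (hS y))
      map_smul' := fun c x => tendsto_nhds_unique (hS (c • x)) (by simpa using (hS x).const_smul c)
      norm_map' := fun x => tendsto_nhds_unique (hS x).norm (by simp) }
  exact ⟨T.toLinearIsometryEquiv rfl, hS⟩

theorem exists_tendsto_lipschitzWith {ι E F : Type*} [SeminormedAddCommGroup E]
    [NormedAddCommGroup F] [ProperSpace F] {U : Ultrafilter ι} {L : ℝ≥0} {g : ι → E → F}
    (hg : ∀ᶠ i in (U : Filter ι), LipschitzWith L (g i))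
    (h0 : ∀ᶠ i in (U : Filter ι), g i 0 = 0) :
    ∃ g₀ : E → F, LipschitzWith L g₀ ∧ ∀ y, Tendsto (fun i => g i y) U (𝓝 (g₀ y)) := by
  have h : ∀ y : E, ∃ c, Tendsto (fun i => g i y) U (𝓝 c) := fun y => by
    refine exists_tendsto_of_eventually_norm_le (C := L * ‖y‖) ?_
    filter_upwards [hg, h0] with i hi h0i
    simpa [h0i] using hi.dist_le_mul y 0
  choose g₀ hg₀ using h
  refine ⟨g₀, LipschitzWith.of_dist_le_mul fun x y => ?_, hg₀⟩
  exact le_of_tendsto ((hg₀ x).dist (hg₀ y)) (hg.mono fun i hi => hi.dist_le_mul x y)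

theorem tendsto_prod_nhds_of_lipschitzWith {ι X Y : Type*} [PseudoMetricSpace X]
    [PseudoMetricSpace Y] {l : Filter ι} {K : ℝ≥0} {F : ι → X → Y} {F₀ : X → Y}
    (hF : ∀ᶠ i in l, LipschitzWith K (F i)) {y : X} (hy : Tendsto (fun i => F i y) l (𝓝 (F₀ y))) :
    Tendsto (fun p : ι × X => F p.1 p.2) (l ×ˢ 𝓝 y) (𝓝 (F₀ y)) := by
  refine tendsto_of_tendsto_of_dist (hy.comp tendsto_fst) ?_
  have hdist : Tendsto (fun p : ι × X => K * dist y p.2) (l ×ˢ 𝓝 y) (𝓝 (K * dist y y)) :=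
    (tendsto_const_nhds.dist tendsto_snd).const_mul _
  rw [dist_self, mul_zero] at hdist
  refine squeeze_zero' (Eventually.of_forall fun _ => dist_nonneg) ?_ hdist
  exact (tendsto_fst.eventually hF).mono fun p hp => hp.dist_le_mul y p.2

/-- The height of the point `y` above the graph of a function `g` of the first two coordinates. -/
def heightAbove (g : EuclideanSpace ℝ (Fin 2) → ℝ) (y : E3) : ℝ := y 2 - g !₂[y 0, y 1]

theorem heightAbove_zero (g : EuclideanSpace ℝ (Fin 2) → ℝ) : heightAbove g 0 = -g 0 := by
  have h0 : (!₂[(0 : E3) 0, (0 : E3) 1] : EuclideanSpace ℝ (Fin 2)) = 0 := by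
    ext i
    fin_cases i <;> rfl
  rw [heightAbove, h0]
  exact zero_sub _

theorem heightAbove_add_smul_single (g : EuclideanSpace ℝ (Fin 2) → ℝ) (y : E3) (t : ℝ) :
    heightAbove g (y + t • EuclideanSpace.single 2 1) = heightAbove g y + t := by
  simp [heightAbove]
  ring

theorem lipschitzWith_horizontal :
    LipschitzWith 1 fun y : E3 => (!₂[y 0, y 1] : EuclideanSpace ℝ (Fin 2)) := by
  refine LipschitzWith.mk_one fun y z => ?_
  rw [EuclideanSpace.dist_eq, EuclideanSpace.dist_eq]
  refine Real.sqrt_le_sqrt ?_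
  simp only [Fin.sum_univ_two, Fin.sum_univ_three]
  exact le_add_of_nonneg_right (sq_nonneg _)

theorem lipschitzWith_heightAbove {g : EuclideanSpace ℝ (Fin 2) → ℝ} {L : ℝ≥0}
    (hg : LipschitzWith L g) : LipschitzWith (1 + L * 1) (heightAbove g) := by
  refine LipschitzWith.sub (LipschitzWith.mk_one fun y z => ?_)
    (hg.comp lipschitzWith_horizontal)
  exact dist_eq_norm y z ▸ PiLp.norm_apply_le (y - z) 2

theorem isLipschitzGraphNear_iff {s : Set E3} {L : ℝ≥0} {δ : ℝ} {x : E3} :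
    IsLipschitzGraphNear s L δ x ↔
      ∃ R g, LipschitzWith L g ∧ IsSuperlevelNear s δ x R (heightAbove g) := by
  simp only [IsLipschitzGraphNear, IsSuperlevelNear, heightAbove, sub_pos]

theorem exists_tendstoSuperlevel_heightAbove {B : Set E3} {L : ℝ≥0} {δ : ℝ} (hδ : 0 < δ)
    {U : Ultrafilter (Set E3)} (hU : ∀ᶠ s in (U : Filter (Set E3)), s ∈ admissibleShapes B L δ)
    {x : E3} (hx : x ∈ limitBoundary (U : Filter (Set E3))) :
    ∃ z R, ∃ g : Set E3 → EuclideanSpace ℝ (Fin 2) → ℝ, ∃ R₀ g₀, LipschitzWith L g₀ ∧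
      TendstoSuperlevel U δ z R (fun s => heightAbove (g s)) x R₀ (heightAbove g₀) := by
  obtain ⟨z, hz, hzU⟩ := exists_tendsto_mem_frontier hx
  obtain ⟨R, hR⟩ := ((hU.and hzU).mono fun s hs =>
    isLipschitzGraphNear_iff.1 (hs.1.2.2 _ hs.2)).choice
  obtain ⟨g, hg⟩ := hR.choice
  have hg0 : ∀ᶠ s in (U : Filter (Set E3)), g s 0 = 0 := by
    filter_upwards [hg, hzU] with s hs hzs
    have h0 := hs.2.apply_zero_of_mem_frontier hδ (lipschitzWith_heightAbove hs.1).continuous hzs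
    rwa [heightAbove_zero, neg_eq_zero] at h0
  have hgL := hg.mono fun _ hs => hs.1
  obtain ⟨R₀, hR₀⟩ := exists_tendsto_linearIsometryEquiv U R
  obtain ⟨g₀, hg₀L, hg₀⟩ := exists_tendsto_lipschitzWith hgL hg0
  exact ⟨z, R, g, R₀, g₀, hg₀L,
    { eventually_isSuperlevelNear := hg.mono fun _ hs => hs.2
      tendsto_center := hz
      tendsto_frame := hR₀
      tendsto_height := fun y => tendsto_prod_nhds_of_lipschitzWith
        (hgL.mono fun _ hs => lipschitzWith_heightAbove hs) (tendsto_const_nhds.sub (hg₀ _)) }⟩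

theorem innerLimit_mem_admissibleShapes {B : Set E3} {L : ℝ≥0} {δ : ℝ} (hδ : 0 < δ)
    {U : Ultrafilter (Set E3)} (hU : ∀ᶠ s in (U : Filter (Set E3)), s ∈ admissibleShapes B L δ) :
    innerLimit (U : Filter (Set E3)) ∈ admissibleShapes B L δ := by
  refine ⟨innerLimit_subset (hU.mono fun _ hs => hs.1), isOpen_innerLimit _, fun x hx => ?_⟩
  obtain ⟨_, _, _, R₀, g₀, hg₀, h⟩ :=
    exists_tendstoSuperlevel_heightAbove hδ hU (frontier_innerLimit_subset _ hx)
  exact isLipschitzGraphNear_iff.2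
    ⟨R₀, g₀, hg₀, h.isSuperlevelNear_innerLimit (heightAbove_add_smul_single g₀)⟩

theorem volume_limitBoundary_eq_zero {B : Set E3} {L : ℝ≥0} {δ : ℝ} (hδ : 0 < δ)
    {U : Ultrafilter (Set E3)} (hU : ∀ᶠ s in (U : Filter (Set E3)), s ∈ admissibleShapes B L δ) :
    volume (limitBoundary (U : Filter (Set E3))) = 0 := by
  refine measure_null_of_locally_null _ fun x hx => ?_
  obtain ⟨_, _, _, _, g₀, hg₀, h⟩ := exists_tendstoSuperlevel_heightAbove hδ hU hx
  exact ⟨_, inter_mem_nhdsWithin _ (ball_mem_nhds x hδ),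
    h.measure_limitBoundary_inter_ball_eq_zero volume
      (lipschitzWith_heightAbove hg₀).continuous.measurable (heightAbove_add_smul_single g₀)⟩

theorem exists_tendsto_volume_symmDiff {B : Set E3} {L : ℝ≥0} {δ : ℝ} (hB : volume B ≠ ∞)
    (hδ : 0 < δ) {U : Ultrafilter (Set E3)} (hU : admissibleShapes B L δ ∈ U) :
    ∃ t ∈ admissibleShapes B L δ, Tendsto (fun s => volume (symmDiff s t)) U (𝓝 0) := by
  have ht := innerLimit_mem_admissibleShapes hδ hU
  refine ⟨_, ht, ?_⟩
  have : IsFiniteMeasure (volume.restrict B) := isFiniteMeasure_restrict.2 hB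
  have hnull : volume.restrict B (limitBoundary (U : Filter (Set E3))) = 0 :=
    Measure.absolutelyContinuous_of_le Measure.restrict_le_self
      (volume_limitBoundary_eq_zero hδ hU)
  refine (tendsto_measure_symmDiff_innerLimit hnull).congr' ?_
  filter_upwards [hU] with s hs
  exact Measure.restrict_eq_self _ (symmDiff_le_sup.trans (sup_le hs.1 ht.1))

theorem empty_mem_admissibleShapes (B : Set E3) (L : ℝ≥0) (δ : ℝ) : ∅ ∈ admissibleShapes B L δ :=
  ⟨empty_subset B, isOpen_empty, by simp⟩

/-! ### Minimization by ultrafilter compactness -/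

theorem exists_forall_le_of_ultrafilter {α β : Type*} [ConditionallyCompleteLinearOrder β]
    [TopologicalSpace β] [OrderTopology β] {A : Set α} (hA : A.Nonempty) {J : α → β}
    (h : ∀ U : Ultrafilter α, A ∈ U → ∃ t ∈ A, Tendsto J U (𝓝 (J t))) :
    ∃ t ∈ A, ∀ s ∈ A, J t ≤ J s := by
  have hcompact : IsCompact (J '' A) := isCompact_iff_ultrafilter_le_nhds.2 fun V hV => by
    have hVA : J '' A ∈ V := le_principal_iff.1 hV
    obtain ⟨t, ht, hJ⟩ := h (Ultrafilter.ofComapInfPrincipal hVA)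
      (Ultrafilter.ofComapInfPrincipal_mem hVA)
    refine ⟨J t, mem_image_of_mem J ht, ?_⟩
    rwa [Tendsto, ← Ultrafilter.coe_map, Ultrafilter.ofComapInfPrincipal_eq_of_map] at hJ
  obtain ⟨_, ⟨t, ht, rfl⟩, hleast⟩ := hcompact.exists_isLeast (hA.image J)
  exact ⟨t, ht, fun s hs => hleast (mem_image_of_mem J hs)⟩

/-! ### Variational inequalities of the second kind -/

section VariationalInequality

variable {X : Type*} [NormedAddCommGroup X] [NormedSpace ℝ X]

theorem le_apply_of_le_apply_segment {K : Set X} {F : X → ℝ} {m : ℝ} (hm : 0 ≤ m)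
    (hF : StrongConvexOn K m F) {u v : X} (hu : u ∈ K) (hv : v ∈ K) {t c : ℝ} (ht0 : 0 < t)
    (ht_half : t ≤ 1 / 2) (hc : c ≤ F ((1 - t) • u + t • v)) :
    F u - (F u - c) / t + m / 4 * ‖u - v‖ ^ 2 ≤ F v := by
  have hconv := hc.trans (hF.2 hu hv (by linarith) ht0.le (sub_add_cancel 1 t))
  simp only [smul_eq_mul] at hconv
  have hquad : t * (m / 4 * ‖u - v‖ ^ 2) ≤ (1 - t) * t * (m / 2 * ‖u - v‖ ^ 2) := by
    have : 0 ≤ t * (m * ‖u - v‖ ^ 2) := by positivity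
    nlinarith
  have hdiv : t * ((F u - c) / t) = F u - c := mul_div_cancel₀ _ ht0.ne'
  refine le_of_mul_le_mul_left ?_ ht0
  linarith

theorem bddBelow_image_of_strongConvexOn {K : Set X} {F : X → ℝ} {m : ℝ} (hm : 0 < m)
    (hF : StrongConvexOn K m F) {u : X} (hu : u ∈ K) (hFu : ContinuousWithinAt F K u) :
    BddBelow (F '' K) := by
  obtain ⟨r, hr, hball⟩ : ∃ r > 0, ∀ w ∈ K, dist w u < r → F u - 1 < F w := by
    have h := Metric.mem_nhdsWithin_iff.1 (hFu (Ioi_mem_nhds (sub_one_lt (F u))))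
    exact h.imp fun r hr => ⟨hr.1, fun w hw hwr => hr.2 ⟨hwr, hw⟩⟩
  refine ⟨F u - 1 - 4 / (m * r ^ 2), ?_⟩
  rintro _ ⟨v, hv, rfl⟩
  have hconst : 0 < 4 / (m * r ^ 2) := by positivity
  rcases lt_or_ge (dist v u) r with hnear | hfar
  · linarith [hball v hv hnear]
  -- The point of the segment at distance `r / 2` from `u` transfers the local bound to `v`.
  set d := ‖u - v‖ with hd
  rw [dist_eq_norm', ← hd] at hfar
  have hd0 : 0 < d := hr.trans_le hfar
  set t := r / (2 * d) with ht
  have ht0 : 0 < t := by positivity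
  have ht_half : t ≤ 1 / 2 := by
    rw [ht, div_le_div_iff₀ (by positivity) two_pos]
    linarith
  have hdist : dist ((1 - t) • u + t • v) u < r := by
    have hsub : (1 - t) • u + t • v - u = t • (v - u) := by module
    have htd : t * d = r / 2 := by
      rw [ht]
      field_simp
    rw [dist_eq_norm, hsub, norm_smul, Real.norm_of_nonneg ht0.le, norm_sub_rev, ← hd, htd]
    exact half_lt_self hr
  have hmem := hF.1 hu hv (by linarith) ht0.le (sub_add_cancel 1 t)
  have hlow := le_apply_of_le_apply_segment hm.le hF hu hv ht0 ht_half (hball _ hmem hdist).le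
  rw [sub_sub_cancel, ← hd] at hlow
  have hsquare : 0 ≤ m / 4 * (d - 4 / (m * r)) ^ 2 := by positivity
  have hexpand : m / 4 * (d - 4 / (m * r)) ^ 2 = m / 4 * d ^ 2 - 1 / t + 4 / (m * r ^ 2) := by
    rw [ht]
    field_simp
    ring
  linarith

theorem exists_isMinOn_of_strongConvexOn [CompleteSpace X] {K : Set X} (hK : IsClosed K)
    (hne : K.Nonempty) {F : X → ℝ} {m : ℝ} (hm : 0 < m) (hF : StrongConvexOn K m F)
    (hFc : ContinuousOn F K) : ∃ u ∈ K, IsMinOn F K u := by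
  obtain ⟨u₀, hu₀⟩ := hne
  have hbdd := bddBelow_image_of_strongConvexOn hm hF hu₀ (hFc u₀ hu₀)
  set I := sInf (F '' K)
  have hI : ∀ v ∈ K, I ≤ F v := fun v hv => csInf_le hbdd (mem_image_of_mem F hv)
  have hclose : ∀ v ∈ K, ∀ w ∈ K, m / 8 * ‖v - w‖ ^ 2 ≤ (F v - I) / 2 + (F w - I) / 2 :=
    fun v hv w hw => by
      have hmem := hF.1 hv hw one_half_pos.le one_half_pos.le (add_halves 1)
      have hmid := hF.2 hv hw one_half_pos.le one_half_pos.le (add_halves 1)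
      have hle := (hI _ hmem).trans hmid
      simp only [smul_eq_mul] at hle
      linarith
  let l : Filter X := comap F (𝓝 I) ⊓ 𝓟 K
  have hl : l.NeBot := inf_principal_neBot_iff.2 fun V hV => by
    obtain ⟨W, hW, hWV⟩ := mem_comap.1 hV
    have hIcl : I ∈ closure (F '' K) := csInf_mem_closure ⟨_, mem_image_of_mem F hu₀⟩ hbdd
    obtain ⟨_, hvW, v, hv, rfl⟩ := mem_closure_iff_nhds.1 hIcl W hW
    exact ⟨v, hWV hvW, hv⟩
  have hcauchy : Cauchy l := by
    refine Metric.cauchy_iff.2 ⟨hl, fun η hη => ?_⟩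
    have hpos : 0 < m / 8 * η ^ 2 := by positivity
    refine ⟨F ⁻¹' Iio (I + m / 8 * η ^ 2) ∩ K, inter_mem_inf
      (preimage_mem_comap (Iio_mem_nhds (lt_add_of_pos_right I hpos))) (mem_principal_self K), ?_⟩
    rintro v ⟨hv, hvK⟩ w ⟨hw, hwK⟩
    have hlt : m / 8 * ‖v - w‖ ^ 2 < m / 8 * η ^ 2 := by
      linarith [hclose v hvK w hwK, mem_Iio.1 (mem_preimage.1 hv), mem_Iio.1 (mem_preimage.1 hw)]
    rw [dist_eq_norm]
    exact lt_of_pow_lt_pow_left₀ 2 hη.le (lt_of_mul_lt_mul_left hlt (by positivity))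
  obtain ⟨u, huK, hu⟩ := hK.isComplete l hcauchy inf_le_right
  have hFu : F u = I := tendsto_nhds_unique ((hFc u huK).mono_left (le_inf hu inf_le_right))
    (tendsto_comap.mono_left inf_le_left)
  exact ⟨u, huK, fun v hv => hFu.trans_le (hI v hv)⟩

theorem strongConvexOn_half_bilinear {a : X →L[ℝ] X →L[ℝ] ℝ} {C : ℝ}
    (ha : ∀ v, C * ‖v‖ * ‖v‖ ≤ a v v) {K : Set X} (hK : Convex ℝ K) :
    StrongConvexOn K C fun v => 1 / 2 * a v v := by
  refine ⟨hK, fun v _ w _ α β hα hβ hαβ => ?_⟩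
  have hquad : a (α • v + β • w) (α • v + β • w) =
      α * a v v + β * a w w - α * β * a (v - w) (v - w) := by
    obtain rfl : β = 1 - α := by linarith
    simp only [map_add, map_smul, map_sub, add_apply, sub_apply, smul_apply, smul_eq_mul]
    ring
  have hcoer := mul_le_mul_of_nonneg_left (ha (v - w)) (mul_nonneg hα hβ)
  simp only [smul_eq_mul]
  rw [hquad]
  linarith

/-- `u` solves the variational inequality of the second kind on `K` for the bilinear form `a` and
the functional `F`, into which the linear right-hand side is absorbed. -/
def SolvesVI (a : X →L[ℝ] X →L[ℝ] ℝ) (F : X → ℝ) (K : Set X) (u : X) : Prop :=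
  u ∈ K ∧ ∀ v ∈ K, F u ≤ a u (v - u) + F v

theorem solvesVI_of_isMinOn {a : X →L[ℝ] X →L[ℝ] ℝ} (hsymm : ∀ v w, a v w = a w v) {F : X → ℝ}
    {K : Set X} (hF : ConvexOn ℝ K F) {u : X} (hu : u ∈ K)
    (hmin : IsMinOn (fun v => 1 / 2 * a v v + F v) K u) : SolvesVI a F K u := by
  refine ⟨hu, fun v hv => ?_⟩
  have hsegment : ∀ᶠ t in 𝓝[>] (0 : ℝ),
      F u ≤ a u (v - u) + F v + t * (1 / 2 * a (v - u) (v - u)) := by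
    filter_upwards [Ioc_mem_nhdsGT one_pos] with t ⟨ht0, ht1⟩
    have hcomb : (1 - t) • u + t • v = u + t • (v - u) := by module
    have hmem := hF.1 hu hv (sub_nonneg.2 ht1) ht0.le (sub_add_cancel 1 t)
    have hconv := hF.2 hu hv (sub_nonneg.2 ht1) ht0.le (sub_add_cancel 1 t)
    rw [hcomb] at hmem hconv
    have hmin_t : 1 / 2 * a u u + F u ≤ 1 / 2 * a (u + t • (v - u)) (u + t • (v - u)) +
      F (u + t • (v - u)) := hmin hmem
    have hquad : a (u + t • (v - u)) (u + t • (v - u)) =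
        a u u + 2 * t * a u (v - u) + t ^ 2 * a (v - u) (v - u) := by
      simp only [map_add, map_smul, add_apply, smul_apply, smul_eq_mul]
      rw [hsymm (v - u) u]
      ring
    rw [smul_eq_mul, smul_eq_mul] at hconv
    refine le_of_mul_le_mul_left ?_ ht0
    linarith
  have hlim : Continuous fun t : ℝ => a u (v - u) + F v + t * (1 / 2 * a (v - u) (v - u)) := by
    fun_prop
  exact ge_of_tendsto ((hlim.tendsto' 0 _ (by simp)).mono_left nhdsWithin_le_nhds) hsegment

theorem exists_solvesVI [CompleteSpace X] {a : X →L[ℝ] X →L[ℝ] ℝ} (ha : IsCoercive a)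
    (hsymm : ∀ v w, a v w = a w v) {K : Set X} (hK : IsClosed K) (hne : K.Nonempty) {F : X → ℝ}
    (hF : ConvexOn ℝ K F) (hFc : ContinuousOn F K) : ∃ u, SolvesVI a F K u := by
  obtain ⟨C, hC, hcoer⟩ := ha
  have hstrong : StrongConvexOn K C fun v => 1 / 2 * a v v + F v := by
    have h := (strongConvexOn_half_bilinear hcoer hF.1).add (uniformConvexOn_zero.2 hF)
    rwa [add_zero] at h
  have hcont : ContinuousOn (fun v => 1 / 2 * a v v + F v) K :=
    ((a.continuous.clm_apply continuous_id).const_mul _).continuousOn.add hFc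
  obtain ⟨u, hu, hmin⟩ := exists_isMinOn_of_strongConvexOn hK hne hC hstrong hcont
  exact ⟨u, solvesVI_of_isMinOn hsymm hF hu hmin⟩

theorem SolvesVI.norm_sub_le {a : X →L[ℝ] X →L[ℝ] ℝ} {C : ℝ} (ha : ∀ v, C * ‖v‖ * ‖v‖ ≤ a v v)
    {F F' : X → ℝ} {D : ℝ} (hD : 0 ≤ D) (hFF' : ∀ v w, F v - F' v - (F w - F' w) ≤ D * ‖v - w‖)
    {K : Set X} {u u' : X} (hu : SolvesVI a F K u) (hu' : SolvesVI a F' K u') :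
    C * ‖u - u'‖ ≤ D := by
  rcases (norm_nonneg (u - u')).eq_or_lt with h0 | hpos
  · rwa [← h0, mul_zero]
  refine le_of_mul_le_mul_right ?_ hpos
  have hsum : a u (u' - u) + a u' (u - u') = -a (u - u') (u - u') := by
    simp only [map_sub, sub_apply]
    ring
  have hF := hFF' u' u
  rw [norm_sub_rev] at hF
  linarith [ha (u - u'), hu.2 u' hu'.1, hu'.2 u hu.1]

theorem SolvesVI.eq {a : X →L[ℝ] X →L[ℝ] ℝ} (ha : IsCoercive a) {F : X → ℝ} {K : Set X} {u u' : X}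
    (hu : SolvesVI a F K u) (hu' : SolvesVI a F K u') : u = u' := by
  obtain ⟨C, hC, hcoer⟩ := ha
  have h := hu.norm_sub_le hcoer le_rfl (fun v w => by simp) hu'
  exact sub_eq_zero.1 (norm_le_zero_iff.1 (nonpos_of_mul_nonpos_right h hC))

end VariationalInequality

/-! ### Quadratic and convex integral functionals on `L²` -/

section L2Forms

variable {α : Type*} [MeasurableSpace α] {μ : Measure α} {E : Type*} [NormedAddCommGroup E]
  [InnerProductSpace ℝ E] {T : α → E →L[ℝ] E}

/-- The bilinear form `(v, w) ↦ ∫ ⟪T v, w⟫` on `L²` with a bounded operator-valued coefficient. -/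
noncomputable def coefficientForm (hT : MemLp T ∞ μ) : Lp E 2 μ →L[ℝ] Lp E 2 μ →L[ℝ] ℝ :=
  (innerSL ℝ).comp ((ContinuousLinearMap.id ℝ (E →L[ℝ] E)).holderL μ ∞ 2 2 hT.toLp)

theorem coeFn_holder_toLp (hT : MemLp T ∞ μ) (v : Lp E 2 μ) :
    (ContinuousLinearMap.id ℝ (E →L[ℝ] E)).holderL μ ∞ 2 2 hT.toLp v =ᵐ[μ]
      fun x => T x (v x) := by
  filter_upwards [hT.coeFn_toLp,
    (ContinuousLinearMap.id ℝ (E →L[ℝ] E)).coeFn_holder (r := 2) hT.toLp v] with x hTx hx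
  exact hx.trans (by rw [hTx, ContinuousLinearMap.id_apply])

theorem integrable_inner_apply (hT : MemLp T ∞ μ) (v w : Lp E 2 μ) :
    Integrable (fun x => inner ℝ (T x (v x)) (w x)) μ :=
  (L2.integrable_inner (𝕜 := ℝ) _ w).congr <|
    (coeFn_holder_toLp hT v).mono fun x hx => congrArg (inner ℝ · (w x)) hx

theorem coefficientForm_apply (hT : MemLp T ∞ μ) (v w : Lp E 2 μ) :
    coefficientForm hT v w = ∫ x, inner ℝ (T x (v x)) (w x) ∂μ :=
  (L2.inner_def (𝕜 := ℝ) _ w).trans <| integral_congr_ae <|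
    (coeFn_holder_toLp hT v).mono fun x hx => congrArg (inner ℝ · (w x)) hx

theorem inner_toLp_eq_integral {g : α → E} (hg : MemLp g 2 μ) (v : Lp E 2 μ) :
    inner ℝ hg.toLp v = ∫ x, inner ℝ (g x) (v x) ∂μ :=
  (L2.inner_def (𝕜 := ℝ) _ v).trans <| integral_congr_ae <|
    hg.coeFn_toLp.mono fun x hx => by simp only [hx]

theorem continuous_setIntegral_mul_norm_sub_sq {s : Set α} {κ : α → ℝ} {g : α → E}
    (hκ : MemLp κ ∞ (μ.restrict s)) (hg : MemLp g 2 (μ.restrict s)) :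
    Continuous fun v : Lp E 2 μ => ∫ x in s, κ x * ‖v x - g x‖ ^ 2 ∂μ := by
  have hT : MemLp (fun x => κ x • ContinuousLinearMap.id ℝ E) ∞ (μ.restrict s) :=
    ((ContinuousLinearMap.id ℝ ℝ).smulRight (ContinuousLinearMap.id ℝ E)).comp_memLp' hκ
  let residual : Lp E 2 μ → Lp E 2 (μ.restrict s) := fun v =>
    LpToLpRestrictCLM α E ℝ μ 2 s v - hg.toLp
  have hresidual : Continuous residual :=
    (LpToLpRestrictCLM α E ℝ μ 2 s).continuous.sub continuous_const
  refine (((coefficientForm hT).continuous.comp hresidual).clm_apply hresidual).congr fun v => ?_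
  rw [Function.comp_apply, coefficientForm_apply]
  refine integral_congr_ae ?_
  filter_upwards [Lp.coeFn_sub (LpToLpRestrictCLM α E ℝ μ 2 s v) hg.toLp,
    LpToLpRestrictCLM_coeFn ℝ s v, hg.coeFn_toLp] with x hsub hv hgx
  rw [hsub, Pi.sub_apply, hv, hgx, smul_apply, ContinuousLinearMap.id_apply,
    real_inner_smul_left, real_inner_self_eq_norm_sq]

end L2Forms

section EllipticCoefficients

variable {α : Type*} [MeasurableSpace α] {μ : Measure α} {n : Type*} [Fintype n] [DecidableEq n]
  {A : α → Matrix n n ℝ}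

/-- Bounded, symmetric and uniformly positive definite matrix-valued coefficients: the part of
`IsMaterialParameter` that matters for the bilinear form. -/
structure IsElliptic (μ : Measure α) (A : α → Matrix n n ℝ) : Prop where
  memLp_top : ∀ i j, MemLp (fun x => A x i j) ∞ μ
  symm : ∀ᵐ x ∂μ, (A x).IsSymm
  posDef : ∃ c : ℝ, 0 < c ∧ ∀ᵐ x ∂μ, ∀ ξ : EuclideanSpace ℝ n,
    c * ‖ξ‖ ^ 2 ≤ inner ℝ ξ (Matrix.toEuclideanLin (A x) ξ)

theorem memLp_toEuclideanCLM {p : ℝ≥0∞} (hA : ∀ i j, MemLp (fun x => A x i j) p μ) :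
    MemLp (fun x => Matrix.toEuclideanCLM (n := n) (𝕜 := ℝ) (A x)) p μ := by
  set S : n → n → EuclideanSpace ℝ n →L[ℝ] EuclideanSpace ℝ n := fun i j =>
    Matrix.toEuclideanCLM (n := n) (𝕜 := ℝ) (Matrix.single i j 1) with hS
  have hsum (x : α) :
      Matrix.toEuclideanCLM (n := n) (𝕜 := ℝ) (A x) = ∑ i, ∑ j, A x i j • S i j := by
    conv_lhs => rw [Matrix.matrix_eq_sum_single (A x)]
    simp only [hS, map_sum, ← map_smul, Matrix.smul_single, smul_eq_mul, mul_one]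
  have hterm (i j : n) : MemLp (fun x => A x i j • S i j) p μ :=
    ((ContinuousLinearMap.id ℝ ℝ).smulRight (S i j)).comp_memLp' (hA i j)
  simp only [hsum]
  exact memLp_finsetSum (f := fun i x => ∑ j, A x i j • S i j) _ fun i _ =>
    memLp_finsetSum (f := fun j x => A x i j • S i j) _ fun j _ => hterm i j

/-- The form `(v, w) ↦ ∫ A v · w` on `L²`. -/
noncomputable def IsElliptic.form (hA : IsElliptic μ A) :
    Lp (EuclideanSpace ℝ n) 2 μ →L[ℝ] Lp (EuclideanSpace ℝ n) 2 μ →L[ℝ] ℝ :=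
  coefficientForm (memLp_toEuclideanCLM hA.memLp_top)

theorem IsElliptic.form_apply (hA : IsElliptic μ A) (v w : Lp (EuclideanSpace ℝ n) 2 μ) :
    hA.form v w = ∫ x, inner ℝ (Matrix.toEuclideanLin (A x) (v x)) (w x) ∂μ :=
  coefficientForm_apply _ v w

theorem IsElliptic.form_comm (hA : IsElliptic μ A) (v w : Lp (EuclideanSpace ℝ n) 2 μ) :
    hA.form v w = hA.form w v := by
  rw [hA.form_apply, hA.form_apply]
  refine integral_congr_ae ?_
  filter_upwards [hA.symm] with x hx
  have hsymm : (Matrix.toEuclideanLin (A x)).IsSymmetric := by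
    rwa [Matrix.isSymmetric_toEuclideanLin_iff, Matrix.IsHermitian,
      Matrix.conjTranspose_eq_transpose_of_trivial]
  exact (hsymm _ _).trans (real_inner_comm _ _)

theorem IsElliptic.isCoercive_form (hA : IsElliptic μ A) : IsCoercive hA.form := by
  obtain ⟨c, hc, hpos⟩ := hA.posDef
  refine ⟨c, hc, fun v => ?_⟩
  rw [mul_assoc, ← real_inner_self_eq_norm_mul_norm, L2.inner_def, ← integral_const_mul,
    hA.form_apply]
  refine integral_mono_ae ((L2.integrable_inner v v).const_mul c)
    (integrable_inner_apply (memLp_toEuclideanCLM hA.memLp_top) v v) ?_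
  filter_upwards [hpos] with x hx
  simpa only [real_inner_self_eq_norm_sq, real_inner_comm] using hx (v x)

theorem IsMaterialParameter.isElliptic {Ω B : Set E3}
    {A : E3 → Matrix (Fin 3) (Fin 3) ℝ} (hA : IsMaterialParameter Ω B A) :
    IsElliptic (volume.restrict Ω) A :=
  ⟨hA.memLp_top, hA.symm, hA.posDef⟩

end EllipticCoefficients

section NormIntegral

variable {α : Type*} [MeasurableSpace α] {μ : Measure α} {E : Type*} [NormedAddCommGroup E]
  {s t : Set α}

theorem integrableOn_norm_of_Lp_two (hs : μ s ≠ ∞) (v : Lp E 2 μ) :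
    IntegrableOn (fun x => ‖v x‖) s μ :=
  have := isFiniteMeasure_restrict.2 hs
  (((Lp.memLp v).restrict s).integrable one_le_two).norm

theorem setIntegral_norm_le (hs : μ s ≠ ∞) (v : Lp E 2 μ) :
    ∫ x in s, ‖v x‖ ∂μ ≤ ‖v‖ * √(μ.real s) := by
  have hv : AEStronglyMeasurable v (μ.restrict s) := (Lp.aestronglyMeasurable v).restrict
  have hHolder : eLpNorm v 1 (μ.restrict s) ≤ eLpNorm v 2 μ * μ s ^ (1 / 2 : ℝ) := by
    have h := eLpNorm_le_eLpNorm_mul_rpow_measure_univ (one_le_two : (1 : ℝ≥0∞) ≤ 2) hv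
    rw [Measure.restrict_apply_univ, ENNReal.toReal_one, ENNReal.toReal_ofNat,
      show (1 / 1 - 1 / 2 : ℝ) = 1 / 2 by norm_num] at h
    exact h.trans (mul_le_mul_left (eLpNorm_restrict_le v 2 μ s) _)
  rw [integral_norm_eq_lintegral_enorm hv, ← eLpNorm_one_eq_lintegral_enorm, Lp.norm_def,
    Measure.real, Real.sqrt_eq_rpow, ENNReal.toReal_rpow, ← ENNReal.toReal_mul]
  exact ENNReal.toReal_mono (ENNReal.mul_ne_top (Lp.eLpNorm_ne_top v)
    (ENNReal.rpow_ne_top_of_nonneg one_half_pos.le hs)) hHolder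

theorem setIntegral_sub_setIntegral_le (hs : MeasurableSet s) (ht : MeasurableSet t)
    {h : α → ℝ} (his : IntegrableOn h s μ) (hit : IntegrableOn h t μ) :
    ∫ x in s, h x ∂μ - ∫ x in t, h x ∂μ ≤ ∫ x in symmDiff s t, |h x| ∂μ := by
  have hist : IntegrableOn h (s \ t) μ := his.mono_set sdiff_subset
  have hits : IntegrableOn h (t \ s) μ := hit.mono_set sdiff_subset
  have hsplit_s := integral_inter_add_sdiff ht his
  have hsplit_t := integral_inter_add_sdiff hs hit
  rw [inter_comm] at hsplit_t
  have hsplit : ∫ x in symmDiff s t, |h x| ∂μ = ∫ x in s \ t, |h x| ∂μ + ∫ x in t \ s, |h x| ∂μ :=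
    setIntegral_union disjoint_sdiff_sdiff (ht.diff hs) hist.abs hits.abs
  have hle_s : ∫ x in s \ t, h x ∂μ ≤ ∫ x in s \ t, |h x| ∂μ :=
    integral_mono hist hist.abs fun x => le_abs_self _
  have hle_t : -∫ x in t \ s, h x ∂μ ≤ ∫ x in t \ s, |h x| ∂μ := by
    rw [← integral_neg]
    exact integral_mono hits.neg hits.abs fun x => neg_le_abs _
  linarith

theorem setIntegral_norm_sub_sub_le (hs : MeasurableSet s) (ht : MeasurableSet t)
    (hμs : μ s ≠ ∞) (hμt : μ t ≠ ∞) (v w : Lp E 2 μ) :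
    ∫ x in s, ‖v x‖ ∂μ - ∫ x in t, ‖v x‖ ∂μ - (∫ x in s, ‖w x‖ ∂μ - ∫ x in t, ‖w x‖ ∂μ) ≤
      ‖v - w‖ * √(μ.real (symmDiff s t)) := by
  have hst : μ (symmDiff s t) ≠ ∞ :=
    measure_ne_top_of_subset (symmDiff_le_sup (a := s) (b := t)) (measure_union_ne_top hμs hμt)
  have hi {r : Set α} (hr : μ r ≠ ∞) :
      Integrable (fun x => ‖v x‖ - ‖w x‖) (μ.restrict r) :=
    (integrableOn_norm_of_Lp_two hr v).sub (integrableOn_norm_of_Lp_two hr w)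
  have hae : ∀ᵐ x ∂μ.restrict (symmDiff s t), |‖v x‖ - ‖w x‖| ≤ ‖(v - w : Lp E 2 μ) x‖ := by
    filter_upwards [ae_restrict_of_ae (Lp.coeFn_sub v w)] with x hx
    rw [hx]
    exact abs_norm_sub_norm_le _ _
  calc
    _ = ∫ x in s, (‖v x‖ - ‖w x‖) ∂μ - ∫ x in t, (‖v x‖ - ‖w x‖) ∂μ := by
      rw [integral_sub (integrableOn_norm_of_Lp_two hμs v) (integrableOn_norm_of_Lp_two hμs w),
        integral_sub (integrableOn_norm_of_Lp_two hμt v) (integrableOn_norm_of_Lp_two hμt w)]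
      ring
    _ ≤ ∫ x in symmDiff s t, |‖v x‖ - ‖w x‖| ∂μ :=
      setIntegral_sub_setIntegral_le hs ht (hi hμs) (hi hμt)
    _ ≤ ∫ x in symmDiff s t, ‖(v - w : Lp E 2 μ) x‖ ∂μ :=
      integral_mono_ae (hi hst).abs (integrableOn_norm_of_Lp_two hst _) hae
    _ ≤ ‖v - w‖ * √(μ.real (symmDiff s t)) := setIntegral_norm_le hst _

theorem continuous_setIntegral_norm (hs : MeasurableSet s) (hμs : μ s ≠ ∞) :
    Continuous fun v : Lp E 2 μ => ∫ x in s, ‖v x‖ ∂μ := by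
  refine (LipschitzWith.of_le_add_mul (Real.toNNReal √(μ.real s)) fun v w => ?_).continuous
  have h := setIntegral_norm_sub_sub_le hs MeasurableSet.empty hμs (by simp) v w
  rw [show symmDiff s ∅ = s from symmDiff_bot s, setIntegral_empty, setIntegral_empty] at h
  rw [dist_eq_norm, Real.coe_toNNReal _ (Real.sqrt_nonneg _), mul_comm]
  linarith

theorem convexOn_setIntegral_norm [NormedSpace ℝ E] (hs : μ s ≠ ∞) :
    ConvexOn ℝ univ fun v : Lp E 2 μ => ∫ x in s, ‖v x‖ ∂μ := by
  refine ⟨convex_univ, fun v _ w _ a b ha hb _ => ?_⟩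
  have hv := (integrableOn_norm_of_Lp_two hs v).const_mul a
  have hw := (integrableOn_norm_of_Lp_two hs w).const_mul b
  rw [smul_eq_mul, smul_eq_mul, ← integral_const_mul, ← integral_const_mul, ← integral_add hv hw]
  refine integral_mono_ae (integrableOn_norm_of_Lp_two hs _) (hv.add hw) (ae_restrict_of_ae ?_)
  filter_upwards [Lp.coeFn_add (a • v) (b • w), Lp.coeFn_smul a v, Lp.coeFn_smul b w]
    with x hadd hav hbw
  rw [hadd, Pi.add_apply, hav, hbw, Pi.smul_apply, Pi.smul_apply]
  refine (norm_add_le _ _).trans_eq ?_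
  rw [norm_smul, norm_smul, Real.norm_of_nonneg ha, Real.norm_of_nonneg hb]

end NormIntegral

/-! ### The variational inequality in `H₀(curl)` -/

section HCurl

variable {Ω : Set E3}

theorem isClosed_HCurl (Ω : Set E3) : IsClosed (HCurl Ω : Set (WithLp 2 (L2 Ω × L2 Ω))) := by
  have hcarrier : (HCurl Ω : Set (WithLp 2 (L2 Ω × L2 Ω))) = ⋂ (φ : E3 → E3) (hφ : IsTestField Ω φ),
      {u | inner ℝ hφ.curl_memLp.toLp u.fst = inner ℝ hφ.memLp.toLp u.snd} := by
    ext u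
    simp only [mem_iInter, mem_ofPred_eq]
    refine forall₂_congr fun φ hφ => ?_
    rw [inner_toLp_eq_integral, inner_toLp_eq_integral]
    simp only [real_inner_comm (u.fst _), real_inner_comm (u.snd _)]
  rw [hcarrier]
  refine isClosed_iInter fun φ => isClosed_iInter fun hφ => isClosed_eq ?_ ?_
  · exact continuous_const.inner (WithLp.fstL 2 ℝ (L2 Ω) (L2 Ω)).continuous
  · exact continuous_const.inner (WithLp.sndL 2 ℝ (L2 Ω) (L2 Ω)).continuous

instance (Ω : Set E3) : CompleteSpace (HCurl Ω) :=
  (isClosed_HCurl Ω).completeSpace_coe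

/-- `vecField` as a continuous linear map. -/
noncomputable def vecFieldL (Ω : Set E3) : HCurl Ω →L[ℝ] L2 Ω :=
  (WithLp.fstL 2 ℝ (L2 Ω) (L2 Ω)).comp (HCurl Ω).subtypeL

/-- `curlField` as a continuous linear map. -/
noncomputable def curlFieldL (Ω : Set E3) : HCurl Ω →L[ℝ] L2 Ω :=
  (WithLp.sndL 2 ℝ (L2 Ω) (L2 Ω)).comp (HCurl Ω).subtypeL

theorem norm_sq_HCurl (u : HCurl Ω) : ‖u‖ ^ 2 = ‖vecField u‖ ^ 2 + ‖curlField u‖ ^ 2 :=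
  WithLp.prod_norm_sq_eq_of_L2 (u : WithLp 2 (L2 Ω × L2 Ω))

theorem norm_vecField_le (u : HCurl Ω) : ‖vecField u‖ ≤ ‖u‖ := by
  refine le_of_sq_le_sq ?_ (norm_nonneg u)
  rw [norm_sq_HCurl]
  exact le_add_of_nonneg_right (sq_nonneg _)

variable {ν ε : E3 → Matrix (Fin 3) (Fin 3) ℝ}

/-- `curlForm` as a continuous bilinear form. -/
noncomputable def curlFormL (hν : IsElliptic (volume.restrict Ω) ν)
    (hε : IsElliptic (volume.restrict Ω) ε) : HCurl Ω →L[ℝ] HCurl Ω →L[ℝ] ℝ :=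
  hν.form.bilinearComp (curlFieldL Ω) (curlFieldL Ω) +
    hε.form.bilinearComp (vecFieldL Ω) (vecFieldL Ω)

theorem curlFormL_eq_add (hν : IsElliptic (volume.restrict Ω) ν)
    (hε : IsElliptic (volume.restrict Ω) ε) (v w : HCurl Ω) : curlFormL hν hε v w =
      hν.form (curlField v) (curlField w) + hε.form (vecField v) (vecField w) :=
  rfl

theorem curlFormL_apply (hν : IsElliptic (volume.restrict Ω) ν)
    (hε : IsElliptic (volume.restrict Ω) ε) (v w : HCurl Ω) :
    curlFormL hν hε v w = curlForm ν ε v w := by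
  rw [curlFormL_eq_add, hν.form_apply, hε.form_apply, curlForm]

theorem curlFormL_comm (hν : IsElliptic (volume.restrict Ω) ν)
    (hε : IsElliptic (volume.restrict Ω) ε) (v w : HCurl Ω) :
    curlFormL hν hε v w = curlFormL hν hε w v := by
  simp only [curlFormL_eq_add, hν.form_comm (curlField v), hε.form_comm (vecField v)]

theorem isCoercive_curlFormL (hν : IsElliptic (volume.restrict Ω) ν)
    (hε : IsElliptic (volume.restrict Ω) ε) : IsCoercive (curlFormL hν hε) := by
  obtain ⟨c, hc, hcoer⟩ := hν.isCoercive_form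
  obtain ⟨c', hc', hcoer'⟩ := hε.isCoercive_form
  refine ⟨min c c', lt_min hc hc', fun v => ?_⟩
  calc
    min c c' * ‖v‖ * ‖v‖ = min c c' * ‖curlField v‖ ^ 2 + min c c' * ‖vecField v‖ ^ 2 := by
      rw [mul_assoc, ← sq, norm_sq_HCurl, mul_add, add_comm]
    _ ≤ c * ‖curlField v‖ ^ 2 + c' * ‖vecField v‖ ^ 2 := by
      gcongr
      exacts [min_le_left c c', min_le_right c c']
    _ ≤ curlFormL hν hε v v := by
      rw [curlFormL_eq_add]
      have hcurl := hcoer (curlField v)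
      have hfield := hcoer' (vecField v)
      rw [mul_assoc, ← sq] at hcurl hfield
      exact add_le_add hcurl hfield

variable {jc : ℝ} {f : E3 → E3} {s t : Set E3}

/-- The functional `φ_s(v) - ∫_Ω f · v`, which turns the variational inequality for the shape `s`
into an instance of `SolvesVI`. -/
noncomputable def potential (jc : ℝ) (f : E3 → E3) (s : Set E3) (v : HCurl Ω) : ℝ :=
  nonsmooth jc s (vecField v) - ∫ x in Ω, inner ℝ (f x) (vecField v x)

theorem isVISolution_iff_solvesVI (hν : IsElliptic (volume.restrict Ω) ν)
    (hε : IsElliptic (volume.restrict Ω) ε) (hf : MemLp f 2 (volume.restrict Ω)) {e : HCurl Ω} :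
    IsVISolution ν ε jc f s e ↔ SolvesVI (curlFormL hν hε) (potential jc f s) (H0Curl Ω) e := by
  refine and_congr_right fun _ => forall₂_congr fun v _ => ?_
  have hlin : ∫ x in Ω, inner ℝ (f x) (vecField (v - e) x) =
      (∫ x in Ω, inner ℝ (f x) (vecField v x)) - ∫ x in Ω, inner ℝ (f x) (vecField e x) := by
    simp only [← inner_toLp_eq_integral hf]
    exact inner_sub_right (𝕜 := ℝ) (E := L2 Ω) hf.toLp (vecField v) (vecField e)
  simp only [hlin, curlFormL_apply, potential]
  constructor <;> intro h <;> linarith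

theorem nonsmooth_eq_of_subset (hs : s ⊆ Ω) (v : E3 → E3) :
    nonsmooth jc s v = jc * ∫ x in s, ‖v x‖ ∂(volume.restrict Ω) := by
  rw [nonsmooth, Measure.restrict_restrict_of_subset hs]

theorem continuous_potential (hf : MemLp f 2 (volume.restrict Ω)) (hsΩ : s ⊆ Ω)
    (hs : MeasurableSet s) (hfin : volume s ≠ ∞) :
    Continuous (potential jc f s : HCurl Ω → ℝ) := by
  have hfin' : (volume.restrict Ω) s ≠ ∞ := by rwa [Measure.restrict_eq_self _ hsΩ]
  unfold potential
  simp only [nonsmooth_eq_of_subset hsΩ, ← inner_toLp_eq_integral hf]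
  exact (((continuous_setIntegral_norm hs hfin').const_mul jc).sub
    (innerSL ℝ hf.toLp).continuous).comp (vecFieldL Ω).continuous

theorem convexOn_potential (hjc : 0 ≤ jc) (hf : MemLp f 2 (volume.restrict Ω)) (hsΩ : s ⊆ Ω)
    (hfin : volume s ≠ ∞) : ConvexOn ℝ univ (potential jc f s : HCurl Ω → ℝ) := by
  have hfin' : (volume.restrict Ω) s ≠ ∞ := by rwa [Measure.restrict_eq_self _ hsΩ]
  have hconv : ConvexOn ℝ univ fun v : L2 Ω =>
      jc * ∫ x in s, ‖v x‖ ∂(volume.restrict Ω) - inner ℝ hf.toLp v :=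
    ((convexOn_setIntegral_norm hfin').smul hjc).sub
      ((innerSL ℝ hf.toLp).toLinearMap.concaveOn convex_univ)
  unfold potential
  simp only [nonsmooth_eq_of_subset hsΩ, ← inner_toLp_eq_integral hf]
  exact hconv.comp_linearMap (vecFieldL Ω).toLinearMap

theorem existsUnique_isVISolution (hν : IsElliptic (volume.restrict Ω) ν)
    (hε : IsElliptic (volume.restrict Ω) ε) (hjc : 0 ≤ jc) (hf : MemLp f 2 (volume.restrict Ω))
    (hsΩ : s ⊆ Ω) (hs : MeasurableSet s) (hfin : volume s ≠ ∞) :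
    ∃! e : HCurl Ω, IsVISolution ν ε jc f s e := by
  simp only [isVISolution_iff_solvesVI hν hε hf]
  exact existsUnique_of_exists_of_unique
    (exists_solvesVI (isCoercive_curlFormL hν hε) (curlFormL_comm hν hε)
      (testFields Ω).isClosed_topologicalClosure ⟨0, (H0Curl Ω).zero_mem⟩
      ((convexOn_potential hjc hf hsΩ hfin).subset (subset_univ _) (H0Curl Ω).convex)
      (continuous_potential hf hsΩ hs hfin).continuousOn)
    fun _ _ he he' => he.eq (isCoercive_curlFormL hν hε) he'

theorem isVISolution_electricField (hν : IsElliptic (volume.restrict Ω) ν)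
    (hε : IsElliptic (volume.restrict Ω) ε) (hjc : 0 ≤ jc) (hf : MemLp f 2 (volume.restrict Ω))
    (hsΩ : s ⊆ Ω) (hs : MeasurableSet s) (hfin : volume s ≠ ∞) :
    IsVISolution ν ε jc f s (electricField Ω ν ε jc f s) :=
  Classical.epsilon_spec (existsUnique_isVISolution hν hε hjc hf hsΩ hs hfin).exists

theorem potential_sub_sub_le (hjc : 0 ≤ jc) (hsΩ : s ⊆ Ω) (htΩ : t ⊆ Ω) (hs : MeasurableSet s)
    (ht : MeasurableSet t) (hsfin : volume s ≠ ∞) (htfin : volume t ≠ ∞) (v w : HCurl Ω) :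
    potential jc f s v - potential jc f t v - (potential jc f s w - potential jc f t w) ≤
      jc * √(volume.real (symmDiff s t)) * ‖v - w‖ := by
  have hst : symmDiff s t ⊆ Ω := fun x hx => hx.elim (fun h => hsΩ h.1) fun h => htΩ h.1
  have hnorm := setIntegral_norm_sub_sub_le (μ := volume.restrict Ω) hs ht
    (by rwa [Measure.restrict_eq_self _ hsΩ]) (by rwa [Measure.restrict_eq_self _ htΩ])
    (vecField v) (vecField w)
  rw [Measure.real, Measure.restrict_eq_self _ hst] at hnorm
  have hle : ‖vecField v - vecField w‖ ≤ ‖v - w‖ := norm_vecField_le (v - w)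
  calc
    _ = jc * (∫ x in s, ‖vecField v x‖ ∂(volume.restrict Ω) -
          ∫ x in t, ‖vecField v x‖ ∂(volume.restrict Ω) -
          (∫ x in s, ‖vecField w x‖ ∂(volume.restrict Ω) -
          ∫ x in t, ‖vecField w x‖ ∂(volume.restrict Ω))) := by
      simp only [potential, nonsmooth_eq_of_subset hsΩ, nonsmooth_eq_of_subset htΩ]
      ring
    _ ≤ jc * (‖v - w‖ * √(volume.real (symmDiff s t))) := by
      gcongr
      exact hnorm.trans (by gcongr; rfl)
    _ = jc * √(volume.real (symmDiff s t)) * ‖v - w‖ := by ring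

end HCurl

/-! ### Continuity of the cost -/

section Cost

variable {Ω B : Set E3} {ν ε : E3 → Matrix (Fin 3) (Fin 3) ℝ} {jc : ℝ} {f : E3 → E3} {κ : E3 → ℝ}
  {Ed : E3 → E3} {ι : Type*} {l : Filter ι} {s : ι → Set E3} {t : Set E3}

theorem tendsto_electricField (hν : IsElliptic (volume.restrict Ω) ν)
    (hε : IsElliptic (volume.restrict Ω) ε) (hjc : 0 ≤ jc) (hf : MemLp f 2 (volume.restrict Ω))
    (hs : ∀ᶠ i in l, s i ⊆ Ω ∧ MeasurableSet (s i) ∧ volume (s i) ≠ ∞) (htΩ : t ⊆ Ω)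
    (ht : MeasurableSet t) (htfin : volume t ≠ ∞)
    (hlim : Tendsto (fun i => volume (symmDiff (s i) t)) l (𝓝 0)) :
    Tendsto (fun i => electricField Ω ν ε jc f (s i)) l (𝓝 (electricField Ω ν ε jc f t)) := by
  obtain ⟨c, hc, hcoer⟩ := isCoercive_curlFormL hν hε
  have hreal : Tendsto (fun i => volume.real (symmDiff (s i) t)) l (𝓝 0) :=
    (ENNReal.tendsto_toReal ENNReal.zero_ne_top).comp hlim
  have hbound : Tendsto (fun i => jc * √(volume.real (symmDiff (s i) t)) / c) l (𝓝 0) := by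
    simpa using (hreal.sqrt.const_mul jc).div_const c
  refine tendsto_iff_norm_sub_tendsto_zero.2
    (squeeze_zero' (Eventually.of_forall fun _ => norm_nonneg _) ?_ hbound)
  filter_upwards [hs] with i ⟨hiΩ, hi, hifin⟩
  rw [le_div_iff₀' hc]
  exact SolvesVI.norm_sub_le hcoer (by positivity)
    (potential_sub_sub_le hjc hiΩ htΩ hi ht hifin htfin)
    ((isVISolution_iff_solvesVI hν hε hf).1
      (isVISolution_electricField hν hε hjc hf hiΩ hi hifin))
    ((isVISolution_iff_solvesVI hν hε hf).1
      (isVISolution_electricField hν hε hjc hf htΩ ht htfin))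

theorem tendsto_measureReal_of_symmDiff {α : Type*} [MeasurableSpace α] {μ : Measure α}
    {s : ι → Set α} {t : Set α} (hs : ∀ᶠ i in l, MeasurableSet (s i) ∧ μ (s i) ≠ ∞)
    (ht : MeasurableSet t) (htfin : μ t ≠ ∞)
    (hlim : Tendsto (fun i => μ (symmDiff (s i) t)) l (𝓝 0)) :
    Tendsto (fun i => μ.real (s i)) l (𝓝 (μ.real t)) := by
  refine tendsto_iff_dist_tendsto_zero.2 (squeeze_zero'
    (Eventually.of_forall fun _ => dist_nonneg) ?_
    ((ENNReal.tendsto_toReal ENNReal.zero_ne_top).comp hlim))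
  filter_upwards [hs] with i ⟨hi, hifin⟩
  exact abs_measureReal_sub_le_measureReal_symmDiff' hi.nullMeasurableSet ht.nullMeasurableSet
    hifin htfin

theorem continuous_tracking (hBΩ : B ⊆ Ω) (hκ : MemLp κ ∞ (volume.restrict B))
    (hEd : MemLp Ed 2 (volume.restrict B)) :
    Continuous fun e : HCurl Ω => ∫ x in B, κ x * ‖vecField e x - Ed x‖ ^ 2 := by
  rw [← Measure.restrict_restrict_of_subset hBΩ] at hκ hEd ⊢
  exact (continuous_setIntegral_mul_norm_sub_sq hκ hEd).comp (vecFieldL Ω).continuous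

theorem tendsto_cost (hBΩ : B ⊆ Ω) (hκ : MemLp κ ∞ (volume.restrict B))
    (hEd : MemLp Ed 2 (volume.restrict B)) (hν : IsElliptic (volume.restrict Ω) ν)
    (hε : IsElliptic (volume.restrict Ω) ε) (hjc : 0 ≤ jc) (hf : MemLp f 2 (volume.restrict Ω))
    (hs : ∀ᶠ i in l, s i ⊆ Ω ∧ MeasurableSet (s i) ∧ volume (s i) ≠ ∞) (htΩ : t ⊆ Ω)
    (ht : MeasurableSet t) (htfin : volume t ≠ ∞)
    (hlim : Tendsto (fun i => volume (symmDiff (s i) t)) l (𝓝 0)) :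
    Tendsto (fun i => cost Ω B ν ε jc f κ Ed (s i)) l (𝓝 (cost Ω B ν ε jc f κ Ed t)) := by
  simp only [cost, setIntegral_const, smul_eq_mul, mul_one]
  exact ((((continuous_tracking hBΩ hκ hEd).tendsto _).comp
    (tendsto_electricField hν hε hjc hf hs htΩ ht htfin hlim)).const_mul (1 / 2)).add
    (tendsto_measureReal_of_symmDiff (hs.mono fun _ h => h.2) ht htfin hlim)

end Cost

theorem MemC1.memLp {F : Type*} [NormedAddCommGroup F] [NormedSpace ℝ F] {U : Set E3} {g : E3 → F}
    (hg : MemC1 U g) (hU : IsOpen U) (hfin : volume U ≠ ∞) (p : ℝ≥0∞) :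
    MemLp g p (volume.restrict U) := by
  have := isFiniteMeasure_restrict.2 hfin
  obtain ⟨C, hC⟩ := hg.2
  exact MemLp.of_bound (hg.1.continuousOn.aestronglyMeasurable hU.measurableSet) C
    ((ae_restrict_mem hU.measurableSet).mono fun x hx => (hC x hx).1)

end ShapeOpt

theorem theorem2p2_general {Ω B : Set E3} {ν ε : E3 → Matrix (Fin 3) (Fin 3) ℝ} {jc : ℝ}
    {f : E3 → E3} {κ : E3 → ℝ} {Ed : E3 → E3} {L : ℝ≥0} {δ : ℝ} (hδ : 0 < δ) (hBΩ : B ⊆ Ω)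
    (hBfin : volume B ≠ ∞)
    (hEd : MemLp Ed 2 (volume.restrict B)) (hκ : MemLp κ ∞ (volume.restrict B)) (hjc : 0 ≤ jc)
    (hν : IsElliptic (volume.restrict Ω) ν) (hε : IsElliptic (volume.restrict Ω) ε)
    (hf : MemLp f 2 (volume.restrict Ω)) :
    (∀ s ∈ admissibleShapes B L δ, ∃! e : HCurl Ω, IsVISolution ν ε jc f s e) ∧
    ∃ s_opt ∈ admissibleShapes B L δ, ∀ s ∈ admissibleShapes B L δ,
      cost Ω B ν ε jc f κ Ed s_opt ≤ cost Ω B ν ε jc f κ Ed s := by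
  have hadm : ∀ s ∈ admissibleShapes B L δ, s ⊆ Ω ∧ MeasurableSet s ∧ volume s ≠ ∞ :=
    fun s hs => ⟨hs.1.trans hBΩ, hs.2.1.measurableSet, measure_ne_top_of_subset hs.1 hBfin⟩
  refine ⟨fun s hs => ?_, exists_forall_le_of_ultrafilter
    ⟨∅, empty_mem_admissibleShapes B L δ⟩ fun U hU => ?_⟩
  · obtain ⟨hsΩ, hsm, hfin⟩ := hadm s hs
    exact existsUnique_isVISolution hν hε hjc hf hsΩ hsm hfin
  · obtain ⟨t, ht, hlim⟩ := exists_tendsto_volume_symmDiff hBfin hδ hU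
    obtain ⟨htΩ, htm, htfin⟩ := hadm t ht
    exact ⟨t, ht, tendsto_cost hBΩ hκ hEd hν hε hjc hf (Filter.mem_of_superset hU hadm) htΩ htm
      htfin hlim⟩

theorem theorem2p2
    (Ω B : Set E3) (hΩ : IsLipschitzDomain Ω) (hΩb : Bornology.IsBounded Ω)
    (hB : IsLipschitzDomain B) (hBΩ : B ⊆ Ω)
    (L : ℝ≥0) (δ : ℝ) (hδ : 0 < δ)
    (Ed : E3 → E3) (hEd : MemC1 B Ed)
    (κ : E3 → ℝ) (hκ : MemC1 B κ) (hκpos : ∀ x ∈ B, 0 < κ x)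
    (jc : ℝ) (hjc : 0 < jc)
    (ν ε : E3 → Matrix (Fin 3) (Fin 3) ℝ)
    (hν : IsMaterialParameter Ω B ν) (hε : IsMaterialParameter Ω B ε)
    (f : E3 → E3) (hf : MemLp f 2 (volume.restrict Ω)) (hfB : MemC1 B f) :
    (∀ s ∈ admissibleShapes B L δ, ∃! e : HCurl Ω, IsVISolution ν ε jc f s e) ∧
    ∃ s_opt ∈ admissibleShapes B L δ, ∀ s ∈ admissibleShapes B L δ,
      cost Ω B ν ε jc f κ Ed s_opt ≤ cost Ω B ν ε jc f κ Ed s := by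
  have hBfin : volume B ≠ ∞ := (hΩb.subset hBΩ).measure_lt_top.ne
  exact theorem2p2_general hδ hBΩ hBfin (hEd.memLp hB.isOpen hBfin 2) (hκ.memLp hB.isOpen hBfin ∞)
    hjc.le hν.isElliptic hε.isElliptic hf
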